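/- Let $\Phi$ be a homogeneous Poisson point process in $\mathbb{R}^2$ with intensity $\lambda>0$: a random locally finite set of points (the access points) such that, for every bounded Borel set $S$ of area $\mu(S)$, $\mathcal{P}\{\Phi(S)=k\}=\frac{(\lambda\mu(S))^k}{k!}e^{-\lambda\mu(S)}$ for all $k\ge 0$, where $\Phi(S)$ is the number of points in $S$, and such that the numbers of points in finitely many pairwise disjoint Borel sets are independent. Let $d_1\le d_2\le\cdots$ be the distances of the access points from the origin (the position of the user), and let $a_i=c\,d_i^{-\alpha}$ with constants $c>0$, $\alpha>0$. Given $R_{\min}>0$, consider all choices of rates $R_i\ge 0$, finitely many of them nonzero, with $\sum_i R_i\ge R_{\min}$, and let $N^*$ be the least $N$ such that the minimum of the total transmit power $\sum_i \frac{2^{R_i}-1}{a_i}$ over all these choices is achieved by one that uses only the links $1,\dots,N$, that is, with $R_i=0$ for all $i>N$. Put $A=2^{R_{\min}/\alpha}$. Then $$\mathcal{P}\{N^*=1\}=\frac{1}{A^2}\qquad\text{and}\qquad \mathcal{P}\{N^*=2\}=\frac{\ln(A^2)}{A^2}.$$ In particular, neither probability depends on $\lambda$. -/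

import Mathlib

open MeasureTheory ProbabilityTheory

noncomputable section

/-- The Euclidean plane. -/
abbrev Plane : Type := EuclideanSpace ℝ (Fin 2)

/-- The number of points (possibly infinite) of the configuration `X` that lie in `S`. -/
def pointCount (X S : Set Plane) : ℕ∞ := (X ∩ S).encard

/-- `Φ` is a homogeneous Poisson point process in the plane with intensity `lam`: a random locally
finite set of points, whose number in a bounded Borel set `S` is Poisson distributed with parameter
`lam * area S`, and whose numbers in finitely many pairwise disjoint Borel sets are independent. -/
structure IsHomogeneousPoissonProcess {Ω : Type*} [MeasurableSpace Ω] (P : Measure Ω)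
    (Φ : Ω → Set Plane) (lam : ℝ) : Prop where
  measurable_count : ∀ S : Set Plane, MeasurableSet S →
    Measurable (fun ω => pointCount (Φ ω) S)
  locallyFinite : ∀ᵐ ω ∂P, ∀ r : ℝ, (Φ ω ∩ Metric.closedBall 0 r).Finite
  count_law : ∀ S : Set Plane, MeasurableSet S → Bornology.IsBounded S → ∀ k : ℕ,
    P.real {ω | pointCount (Φ ω) S = (k : ℕ∞)} =
      (lam * volume.real S) ^ k / (k.factorial : ℝ) * Real.exp (-(lam * volume.real S))
  indep_count : ∀ (n : ℕ) (S : Fin n → Set Plane), (∀ i, MeasurableSet (S i)) →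
    Pairwise (fun i j => Disjoint (S i) (S j)) →
    iIndepFun (fun (i : Fin n) (ω : Ω) => pointCount (Φ ω) (S i)) P

/-- The distance from the origin to its `(i + 1)`-th closest point of the configuration `X`:
the least radius of a closed disc around the origin with at least `i + 1` points of `X`.
So index `0` stands for the closest point, index `1` for the second closest one, and so on. -/
def nearestDist (X : Set Plane) (i : ℕ) : ℝ :=
  sInf {r : ℝ | 0 ≤ r ∧ ((i + 1 : ℕ) : ℕ∞) ≤ pointCount X (Metric.closedBall 0 r)}

/-- The channel coefficient `c * d ^ (-α)` of the link to the `(i + 1)`-th closest access point,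
where `d` is its distance, `α` the path loss exponent and `c` the proportionality constant. -/
def channelCoeff (c α : ℝ) (X : Set Plane) (i : ℕ) : ℝ :=
  c * nearestDist X i ^ (-α)

/-- A (finitely supported) choice of rates `R i` on the links is feasible when the rates are
nonnegative and together reach the required minimum rate (the latency constraint). -/
def IsFeasible (Rmin : ℝ) (R : ℕ →₀ ℝ) : Prop :=
  (∀ i, 0 ≤ R i) ∧ Rmin ≤ R.sum (fun _ r => r)

/-- The total transmit power: rate `r` on a link with coefficient `a i`, whose capacity per unit of
bandwidth at power `p` is `log₂ (1 + a i * p)`, costs the power `(2 ^ r - 1) / a i`. -/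
def totalPower (a : ℕ → ℝ) (R : ℕ →₀ ℝ) : ℝ :=
  R.sum (fun i r => ((2 : ℝ) ^ r - 1) / a i)

/-- `R` minimizes the total transmit power among all feasible choices of rates, over any finite
number of links. -/
def IsPowerOptimal (a : ℕ → ℝ) (Rmin : ℝ) (R : ℕ →₀ ℝ) : Prop :=
  IsFeasible Rmin R ∧ ∀ R' : ℕ →₀ ℝ, IsFeasible Rmin R' → totalPower a R ≤ totalPower a R'

/-- The optimal number of links: the least `N` such that the minimum total transmit power is
achieved by communicating over the first `N` links only. -/
def optimalNumLinks (a : ℕ → ℝ) (Rmin : ℝ) : ℕ :=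
  sInf {N : ℕ | ∃ R : ℕ →₀ ℝ, IsPowerOptimal a Rmin R ∧ R.support ⊆ Finset.range N}

end

/-! The power is convex in the rates, so optimality means equal marginal powers `2 ^ R i / a i = ν`
on the links in use and at least `ν` on the others. Since `a` decreases, one link suffices iff `2 ^
Rmin / a 0 ≤ 1 / a 1`. Two suffice iff the level `ν = √(2 ^ Rmin / (a 0 * a 1))` is at most `1 / a
2`. In terms of distances these read `A * d₁ ≤ d₂` and `A * d₁ * d₂ ≤ d₃ ^ 2`.

The variables `uᵢ = π * lam * dᵢ₊₁ ^ 2` are the points of a unit-rate Poisson process on the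
half-line, so `lam` disappears. With `B = A ^ 2` the events become `B * u₀ ≤ u₁` and `B * u₀ * u₁ ≤
u₂ ^ 2`. The joint density `exp (-u₂)` on `0 < u₀ < u₁ < u₂` makes `s = u₀ / u₁` uniform on `(0, 1]`
and independent of `(u₁, u₂)`, and `u₂ ≥ k * u₁` has probability `1 / k ^ 2` for `k ≥ 1`. Hence the
first event has probability `1 / B`, and the second `∫ 1 / max 1 (B * s) ds = 1 / B + log B / B`
(`firstThreeLaw_mul_fst_le`, `firstThreeLaw_mul_mul_le_sq`). The first event is contained in the
second almost surely, so subtraction gives the case of two links.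

The law of `(u₀, u₁, u₂)` is identified in `map_meanDist` by comparing distribution functions on
ordered boxes, where they reduce to counts in a disc and two annuli. -/

/-! ### Convex power allocation over the links. -/

theorem totalPower_eq_sum (a : ℕ → ℝ) (R : ℕ →₀ ℝ) (s : Finset ℕ) (h : R.support ⊆ s) :
    totalPower a R = ∑ i ∈ s, ((2 : ℝ) ^ R i - 1) / a i :=
  Finsupp.sum_of_support_subset R h _ (by simp)

theorem rateSum_eq_sum (R : ℕ →₀ ℝ) (s : Finset ℕ) (h : R.support ⊆ s) :
    R.sum (fun _ r => r) = ∑ i ∈ s, R i :=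
  Finsupp.sum_of_support_subset R h _ (by simp)

/-- The tangent line inequality for `r ↦ 2 ^ r`. -/
theorem two_rpow_tangent_le (r s : ℝ) :
    (2 : ℝ) ^ r * (Real.log 2 * (s - r)) ≤ 2 ^ s - 2 ^ r := by
  have h1 : (2 : ℝ) ^ s = 2 ^ r * 2 ^ (s - r) := by
    rw [← Real.rpow_add two_pos]; congr 1; ring
  have h2 : Real.log 2 * (s - r) + 1 ≤ (2 : ℝ) ^ (s - r) := by
    rw [Real.rpow_def_of_pos two_pos]; exact Real.add_one_le_exp _
  have h3 : (0 : ℝ) < 2 ^ r := by positivity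
  rw [h1]
  nlinarith

/-- Sufficiency of the Karush-Kuhn-Tucker conditions with multiplier `ν`. -/
theorem isPowerOptimal_of_multiplier (a : ℕ → ℝ) (ha : ∀ i, 0 < a i) (Rmin ν : ℝ) (hν : 0 ≤ ν)
    (R : ℕ →₀ ℝ) (hR : ∀ i, 0 ≤ R i) (hsum : R.sum (fun _ r => r) = Rmin)
    (hle : ∀ i, ν ≤ 2 ^ R i / a i) (heq : ∀ i, R i ≠ 0 → 2 ^ R i / a i = ν) :
    IsPowerOptimal a Rmin R := by
  refine ⟨⟨hR, hsum.ge⟩, fun R' ⟨hR', hsum'⟩ => ?_⟩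
  have hlog : 0 ≤ Real.log 2 := Real.log_nonneg (by norm_num)
  set s := R.support ∪ R'.support
  have hs : R.support ⊆ s := Finset.subset_union_left
  have hs' : R'.support ⊆ s := Finset.subset_union_right
  rw [rateSum_eq_sum R s hs] at hsum
  rw [rateSum_eq_sum R' s hs'] at hsum'
  rw [totalPower_eq_sum a R s hs, totalPower_eq_sum a R' s hs', ← sub_nonneg,
    ← Finset.sum_sub_distrib]
  have key : ∀ i ∈ s, ν * Real.log 2 * (R' i - R i) ≤
      ((2 : ℝ) ^ R' i - 1) / a i - ((2 : ℝ) ^ R i - 1) / a i := by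
    intro i _
    -- An unused link may have slope above `ν`, but there `R' i - R i ≥ 0`, so replacing the slope
    -- by `ν` still bounds from below.
    have h1 : ν * (Real.log 2 * (R' i - R i)) ≤
        2 ^ R i / a i * (Real.log 2 * (R' i - R i)) := by
      by_cases h0 : R i = 0
      · refine mul_le_mul_of_nonneg_right (hle i) (mul_nonneg hlog ?_)
        rw [h0, sub_zero]; exact hR' i
      · rw [heq i h0]
    have h2 := div_le_div_of_nonneg_right (two_rpow_tangent_le (R i) (R' i)) (ha i).le
    rw [← sub_div]
    calc _ = ν * (Real.log 2 * (R' i - R i)) := by ring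
      _ ≤ _ := h1
      _ = (2 : ℝ) ^ R i * (Real.log 2 * (R' i - R i)) / a i := by ring
      _ ≤ _ := h2
      _ = _ := by ring
  refine le_trans ?_ (Finset.sum_le_sum key)
  rw [← Finset.mul_sum, Finset.sum_sub_distrib, hsum]
  exact mul_nonneg (mul_nonneg hν hlog) (sub_nonneg.2 hsum')

/-- At an optimum, the marginal power of a link in use is at most that of any other link. -/
theorem IsPowerOptimal.marginal_le {a : ℕ → ℝ} (ha : ∀ i, 0 < a i) {Rmin : ℝ} {R : ℕ →₀ ℝ}
    (h : IsPowerOptimal a Rmin R) {i j : ℕ} (hi : 0 < R i) :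
    2 ^ R i / a i ≤ 2 ^ R j / a j := by
  rcases eq_or_ne i j with rfl | hij
  · exact le_rfl
  obtain ⟨⟨hR, hsum⟩, hopt⟩ := h
  set p := 2 ^ R i / a i with hp
  set q := 2 ^ R j / a j with hq
  have hp0 : 0 < p := div_pos (by positivity) (ha i)
  -- Shifting a rate `ε` from link `i` to link `j` cannot lower the power; letting `ε → 0` then
  -- compares the slopes.
  have key : ∀ ε, 0 < ε → ε < R i → p ≤ q * 2 ^ ε := by
    intro ε hε hεi
    let R' : ℕ →₀ ℝ := R + Finsupp.single j ε - Finsupp.single i ε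
    have hR'i : R' i = R i - ε := by simp [R', hij.symm]
    have hR'j : R' j = R j + ε := by simp [R', hij]
    have hR'k : ∀ k, k ≠ i ∧ k ≠ j → R' k = R k := by
      intro k hk
      simp [R', hk.1.symm, hk.2.symm]
    set s := R.support ∪ {i, j} with hs_def
    have his : i ∈ s := by simp [s]
    have hjs : j ∈ s := by simp [s]
    have hs : R.support ⊆ s := Finset.subset_union_left
    have hs' : R'.support ⊆ s := by
      intro k hk
      by_cases hki : k = i
      · rwa [hki]
      by_cases hkj : k = j
      · rwa [hkj]
      refine hs ?_
      rw [Finsupp.mem_support_iff] at hk ⊢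
      rwa [← hR'k k ⟨hki, hkj⟩]
    have hfeas : IsFeasible Rmin R' := by
      refine ⟨fun k => ?_, ?_⟩
      · by_cases hki : k = i
        · rw [hki, hR'i]; linarith
        by_cases hkj : k = j
        · rw [hkj, hR'j]; linarith [hR j]
        rw [hR'k k ⟨hki, hkj⟩]; exact hR k
      · refine hsum.trans (le_of_eq ?_)
        rw [rateSum_eq_sum R s hs, rateSum_eq_sum R' s hs', eq_comm, ← sub_eq_zero,
          ← Finset.sum_sub_distrib,
          Finset.sum_eq_add_of_mem i j his hjs hij
            (fun k _ hk => by rw [hR'k k hk, sub_self]), hR'i, hR'j]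
        ring
    have h1 := hopt R' hfeas
    rw [totalPower_eq_sum a R s hs, totalPower_eq_sum a R' s hs', ← sub_nonneg,
      ← Finset.sum_sub_distrib,
      Finset.sum_eq_add_of_mem i j his hjs hij
        (fun k _ hk => by rw [hR'k k hk, sub_self]), hR'i, hR'j] at h1
    have hx : (1 : ℝ) < 2 ^ ε := Real.one_lt_rpow one_lt_two hε
    rw [Real.rpow_sub two_pos, Real.rpow_add two_pos] at h1
    set x := (2 : ℝ) ^ ε
    -- The change of power, multiplied by `x = 2 ^ ε`, factors as `(x - 1) * (q * x - p)`.
    have h2 : 0 ≤ (x - 1) * (q * x - p) := by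
      have : (x - 1) * (q * x - p) = x * ((2 ^ R i / x - 1) / a i - (2 ^ R i - 1) / a i +
          ((2 ^ R j * x - 1) / a j - (2 ^ R j - 1) / a j)) := by
        have := (ha i).ne'
        have := (ha j).ne'
        have : x ≠ 0 := by positivity
        rw [hp, hq]
        field_simp
        ring
      rw [this]
      exact mul_nonneg (by positivity) h1
    linarith [nonneg_of_mul_nonneg_right h2 (by linarith)]
  have hlim : Filter.Tendsto (fun ε : ℝ => q * 2 ^ ε) (nhdsWithin 0 (Set.Ioi 0)) (nhds q) := by
    have : Continuous fun ε : ℝ => q * (2 : ℝ) ^ ε := by fun_prop (disch := norm_num)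
    simpa using (this.tendsto 0).mono_left nhdsWithin_le_nhds
  refine ge_of_tendsto hlim ?_
  filter_upwards [Ioo_mem_nhdsGT hi] with ε hε using key ε hε.1 hε.2

/-- Communicating over the best link alone is optimal iff the second one is bad enough. -/
theorem exists_isPowerOptimal_one_iff {a : ℕ → ℝ} (ha : ∀ i, 0 < a i) (hanti : Antitone a)
    {Rmin : ℝ} (hRmin : 0 < Rmin) :
    (∃ R : ℕ →₀ ℝ, IsPowerOptimal a Rmin R ∧ R.support ⊆ Finset.range 1) ↔
      2 ^ Rmin / a 0 ≤ 1 / a 1 := by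
  constructor
  · rintro ⟨R, hR, hsupp⟩
    have h0 : Rmin ≤ R 0 := by
      have := hR.1.2
      rw [rateSum_eq_sum R _ hsupp] at this
      simpa using this
    have h1 : R 1 = 0 := by
      by_contra h
      simpa using hsupp (Finsupp.mem_support_iff.2 h)
    have := hR.marginal_le ha (i := 0) (j := 1) (by linarith)
    rw [h1, Real.rpow_zero] at this
    refine le_trans (div_le_div_of_nonneg_right ?_ (ha 0).le) this
    exact Real.rpow_le_rpow_of_exponent_le one_le_two h0
  · intro h
    refine ⟨Finsupp.single 0 Rmin, ?_, ?_⟩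
    · refine isPowerOptimal_of_multiplier a ha Rmin (2 ^ Rmin / a 0)
        (div_pos (by positivity) (ha 0)).le _ ?_ (by simp) ?_ ?_
      · intro i
        rw [Finsupp.single_apply]; split_ifs <;> linarith
      · intro i
        rcases Nat.eq_zero_or_pos i with rfl | hi
        · simp
        · rw [Finsupp.single_eq_of_ne hi.ne', Real.rpow_zero]
          exact h.trans (one_div_le_one_div_of_le (ha i) (hanti hi))
      · intro i hi
        rcases Nat.eq_zero_or_pos i with rfl | hi'
        · simp
        · simp [Finsupp.single_eq_of_ne hi'.ne'] at hi
    · exact Finsupp.support_single_subset.trans (by simp)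

/-- Communicating over the best two links is optimal iff the third one is bad enough. -/
theorem exists_isPowerOptimal_two_iff {a : ℕ → ℝ} (ha : ∀ i, 0 < a i) (hanti : Antitone a)
    {Rmin : ℝ} (hRmin : 0 < Rmin) :
    (∃ R : ℕ →₀ ℝ, IsPowerOptimal a Rmin R ∧ R.support ⊆ Finset.range 2) ↔
      2 ^ Rmin / (a 0 * a 1) ≤ (1 / a 2) ^ 2 := by
  have ha0 := ha 0
  have ha1 := ha 1
  have ha2 := ha 2
  constructor
  · rintro ⟨R, hR, hsupp⟩
    have hsum : Rmin ≤ R 0 + R 1 := by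
      have := hR.1.2
      rw [rateSum_eq_sum R _ hsupp] at this
      simpa [Finset.sum_range_succ] using this
    have h2 : R 2 = 0 := by
      by_contra h
      simpa using hsupp (Finsupp.mem_support_iff.2 h)
    -- A link in use is compared with the idle link 2; an idle one is covered by antitonicity. The
    -- product of the bounds for links 0 and 1 gives the claim.
    have hle : ∀ i ≤ 2, 2 ^ R i / a i ≤ 1 / a 2 := by
      intro i hi
      rcases (hR.1.1 i).eq_or_lt with h | h
      · rw [← h, Real.rpow_zero]
        exact one_div_le_one_div_of_le ha2 (hanti hi)
      · simpa [h2] using hR.marginal_le ha (j := 2) h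
    calc 2 ^ Rmin / (a 0 * a 1) ≤ 2 ^ (R 0 + R 1) / (a 0 * a 1) := by
          gcongr
          exact one_le_two
      _ = (2 ^ R 0 / a 0) * (2 ^ R 1 / a 1) := by
          rw [Real.rpow_add two_pos, div_mul_div_comm]
      _ ≤ (1 / a 2) * (1 / a 2) := by
          have := ha 1
          exact mul_le_mul (hle 0 (by norm_num)) (hle 1 (by norm_num)) (by positivity)
            (by positivity)
      _ = _ := by ring
  · intro h
    -- If one link does not suffice, the level `ν` determined by `(ν * a 0) * (ν * a 1) = 2 ^ Rmin`
    -- is at least `1 / a 1`, which makes both rates `logb 2 (ν * a i)` nonnegative.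
    by_cases h1 : 2 ^ Rmin / a 0 ≤ 1 / a 1
    · obtain ⟨R, hR, hs⟩ := (exists_isPowerOptimal_one_iff ha hanti hRmin).2 h1
      exact ⟨R, hR, hs.trans (by simp)⟩
    push Not at h1
    set ν := √(2 ^ Rmin / (a 0 * a 1)) with hν_def
    have hT : (1 : ℝ) ≤ 2 ^ Rmin := Real.one_le_rpow one_le_two hRmin.le
    have hν : 0 < ν := Real.sqrt_pos.2 (by positivity)
    have hνsq : ν ^ 2 = 2 ^ Rmin / (a 0 * a 1) := Real.sq_sqrt (by positivity)
    have h10 : 1 / a 0 ≤ 1 / a 1 := one_div_le_one_div_of_le ha1 (hanti zero_le_one)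
    have hν1 : 1 / a 1 ≤ ν := by
      refine Real.le_sqrt_of_sq_le ?_
      calc (1 / a 1) ^ 2 = 1 / a 1 * (1 / a 1) := sq _
        _ ≤ 2 ^ Rmin / a 0 * (1 / a 1) := by gcongr
        _ = _ := by rw [div_mul_div_comm, mul_one]
    have hν2 : ν ≤ 1 / a 2 := Real.sqrt_le_iff.2 ⟨by positivity, h⟩
    have hge : ∀ i, 1 / a i ≤ ν → 1 ≤ ν * a i := fun i hi => by
      rwa [div_le_iff₀ (ha i)] at hi
    set r : ℕ → ℝ := fun i => Real.logb 2 (ν * a i)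
    have hr : ∀ i, 2 ^ r i / a i = ν := fun i => by
      have := ha i
      simp only [r]
      rw [Real.rpow_logb two_pos (by norm_num) (by positivity)]
      field_simp
    have hr0 : ∀ i, 1 / a i ≤ ν → 0 ≤ r i := fun i hi =>
      Real.logb_nonneg one_lt_two (hge i hi)
    set R : ℕ →₀ ℝ := Finsupp.single 0 (r 0) + Finsupp.single 1 (r 1)
    have hR0 : R 0 = r 0 := by simp [R]
    have hR1 : R 1 = r 1 := by simp [R]
    have hRk : ∀ k, 2 ≤ k → R k = 0 := fun k hk => by
      simp [R, show (0 : ℕ) ≠ k by omega, show (1 : ℕ) ≠ k by omega]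
    have hsupp : R.support ⊆ Finset.range 2 := by
      intro k hk
      by_contra hk'
      exact Finsupp.mem_support_iff.1 hk (hRk k (by simpa [Nat.succ_le_iff] using hk'))
    have hcases : ∀ i : ℕ, i = 0 ∨ i = 1 ∨ 2 ≤ i := fun i => by omega
    refine ⟨R, ?_, hsupp⟩
    refine isPowerOptimal_of_multiplier a ha Rmin ν hν.le R ?_ ?_ ?_ ?_
    · intro i
      rcases hcases i with rfl | rfl | hi
      · rw [hR0]; exact hr0 0 (h10.trans hν1)
      · rw [hR1]; exact hr0 1 hν1
      · rw [hRk i hi]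
    · rw [rateSum_eq_sum R _ hsupp, Finset.sum_range_succ, Finset.sum_range_one, hR0, hR1]
      simp only [r]
      rw [← Real.logb_mul (by positivity) (by positivity),
        show ν * a 0 * (ν * a 1) = ν ^ 2 * (a 0 * a 1) by ring, hνsq,
        div_mul_cancel₀ _ (by positivity), Real.logb_rpow two_pos (by norm_num)]
    · intro i
      rcases hcases i with rfl | rfl | hi
      · rw [hR0, hr]
      · rw [hR1, hr]
      · rw [hRk i hi, Real.rpow_zero]
        exact hν2.trans (one_div_le_one_div_of_le (ha i) (hanti hi))
    · intro i hi0
      rcases hcases i with rfl | rfl | hi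
      · rw [hR0, hr]
      · rw [hR1, hr]
      · exact absurd (hRk i hi) hi0

theorem not_exists_isPowerOptimal_zero {a : ℕ → ℝ} {Rmin : ℝ} (hRmin : 0 < Rmin) :
    ¬ ∃ R : ℕ →₀ ℝ, IsPowerOptimal a Rmin R ∧ R.support ⊆ Finset.range 0 := by
  rintro ⟨R, hR, hs⟩
  have := hR.1.2
  rw [rateSum_eq_sum R _ hs] at this
  simp at this
  linarith

theorem optimalNumLinks_eq_one_iff {a : ℕ → ℝ} (ha : ∀ i, 0 < a i) (hanti : Antitone a)
    {Rmin : ℝ} (hRmin : 0 < Rmin) :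
    optimalNumLinks a Rmin = 1 ↔ 2 ^ Rmin / a 0 ≤ 1 / a 1 := by
  rw [← exists_isPowerOptimal_one_iff ha hanti hRmin, optimalNumLinks]
  set S := {N : ℕ | ∃ R : ℕ →₀ ℝ, IsPowerOptimal a Rmin R ∧ R.support ⊆ Finset.range N}
  change sInf S = 1 ↔ 1 ∈ S
  constructor
  · intro h
    -- A positive infimum excludes the empty set, whose `sInf` is `0` by convention.
    have := Nat.sInf_mem (Nat.nonempty_of_pos_sInf (h ▸ one_pos))
    rwa [h] at this
  · intro h
    refine le_antisymm (Nat.sInf_le h) (Nat.one_le_iff_ne_zero.2 fun h0 => ?_)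
    have := Nat.sInf_mem (Set.nonempty_of_mem h)
    rw [h0] at this
    exact not_exists_isPowerOptimal_zero hRmin this

theorem optimalNumLinks_eq_two_iff {a : ℕ → ℝ} (ha : ∀ i, 0 < a i) (hanti : Antitone a)
    {Rmin : ℝ} (hRmin : 0 < Rmin) :
    optimalNumLinks a Rmin = 2 ↔
      2 ^ Rmin / (a 0 * a 1) ≤ (1 / a 2) ^ 2 ∧ ¬ 2 ^ Rmin / a 0 ≤ 1 / a 1 := by
  rw [← exists_isPowerOptimal_one_iff ha hanti hRmin,
    ← exists_isPowerOptimal_two_iff ha hanti hRmin, optimalNumLinks]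
  set S := {N : ℕ | ∃ R : ℕ →₀ ℝ, IsPowerOptimal a Rmin R ∧ R.support ⊆ Finset.range N}
  change sInf S = 2 ↔ 2 ∈ S ∧ 1 ∉ S
  constructor
  · intro h
    have := Nat.sInf_mem (Nat.nonempty_of_pos_sInf (h ▸ two_pos))
    rw [h] at this
    refine ⟨this, fun h1 => ?_⟩
    have := Nat.sInf_le h1
    omega
  · rintro ⟨h2, h1⟩
    have hmem := Nat.sInf_mem (Set.nonempty_of_mem h2)
    have hle := Nat.sInf_le h2
    generalize sInf S = N at hmem hle
    interval_cases N
    · exact absurd hmem (not_exists_isPowerOptimal_zero hRmin)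
    · exact absurd hmem h1
    · rfl

/-! ### Distances to the points of a fixed configuration. -/

open Metric Filter Topology in
/-- The count in closed discs around the origin is right-continuous in the radius. -/
theorem exists_gt_inter_closedBall_eq {X : Set Plane}
    (hX : ∀ r : ℝ, (X ∩ closedBall 0 r).Finite) (r : ℝ) :
    ∃ r' > r, X ∩ closedBall 0 r' ⊆ X ∩ closedBall 0 r := by
  -- Only finitely many points have norm at most `r + 1`, so those beyond `r` all stay beyond any
  -- `r'` close enough to `r`.
  have hev : ∀ᶠ r' in 𝓝[>] r, ∀ p ∈ X ∩ closedBall 0 (r + 1), r < ‖p‖ → r' < ‖p‖ := by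
    rw [Filter.eventually_all_finite (hX (r + 1))]
    intro p _
    by_cases h : r < ‖p‖
    · filter_upwards [Ioo_mem_nhdsGT h] with r' hr' _ using hr'.2
    · exact Eventually.of_forall fun _ h' => absurd h' h
  obtain ⟨r', hr', hI⟩ := (hev.and (Ioo_mem_nhdsGT (lt_add_one r))).exists
  refine ⟨r', hI.1, fun p hp => ⟨hp.1, ?_⟩⟩
  have hp2 : ‖p‖ ≤ r' := by simpa using hp.2
  by_contra h
  have h' : r < ‖p‖ := by simpa using h
  have := hr' p ⟨hp.1, by simpa using hp2.trans hI.2.le⟩ h'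
  linarith

theorem pointCount_mono (X : Set Plane) {S T : Set Plane} (h : S ⊆ T) :
    pointCount X S ≤ pointCount X T :=
  Set.encard_le_encard (Set.inter_subset_inter_right X h)

theorem pointCount_add_diff (X : Set Plane) {S T : Set Plane} (h : S ⊆ T) :
    pointCount X T = pointCount X S + pointCount X (T \ S) := by
  have hd : Disjoint (X ∩ S) (X ∩ (T \ S)) :=
    Set.disjoint_left.2 fun x hx hx' => hx'.2.2 hx.2
  rw [pointCount, pointCount, pointCount, ← Set.encard_union_eq hd, ← Set.inter_union_distrib_left,
    Set.union_sdiff_cancel h]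

theorem nearestDist_nonneg (X : Set Plane) (i : ℕ) : 0 ≤ nearestDist X i :=
  Real.sInf_nonneg fun _ h => h.1

/-- A locally finite configuration with infinitely many points, none of them at the origin. -/
structure IsRegularConfiguration (X : Set Plane) : Prop where
  locallyFinite : ∀ r : ℝ, (X ∩ Metric.closedBall 0 r).Finite
  exists_count_ge : ∀ k : ℕ, ∃ n : ℕ, (k : ℕ∞) ≤ pointCount X (Metric.closedBall 0 (n : ℝ))
  count_origin : pointCount X (Metric.closedBall 0 0) = 0

namespace IsRegularConfiguration

variable {X : Set Plane}

/-- Right-continuity of the count makes the infimum attained. Infinitely many points keep the set of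
radii nonempty, so the default `sInf ∅ = 0` never intervenes. -/
theorem nearestDist_le_iff (hX : IsRegularConfiguration X) (i : ℕ) {r : ℝ} (hr : 0 ≤ r) :
    nearestDist X i ≤ r ↔ ((i + 1 : ℕ) : ℕ∞) ≤ pointCount X (Metric.closedBall 0 r) := by
  constructor
  · intro h
    obtain ⟨r', hr', hsub⟩ := exists_gt_inter_closedBall_eq hX.locallyFinite r
    obtain ⟨n, hn⟩ := hX.exists_count_ge (i + 1)
    have hlt := h.trans_lt hr'
    rw [nearestDist] at hlt
    obtain ⟨s, hs, hsr⟩ := exists_lt_of_csInf_lt (by exact ⟨(n : ℝ), n.cast_nonneg, hn⟩) hlt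
    exact hs.2.trans ((pointCount_mono X (Metric.closedBall_subset_closedBall hsr.le)).trans
      (Set.encard_le_encard hsub))
  · intro h
    exact csInf_le ⟨0, fun _ h => h.1⟩ ⟨hr, h⟩

theorem nearestDist_pos (hX : IsRegularConfiguration X) (i : ℕ) : 0 < nearestDist X i := by
  by_contra h
  rw [not_lt, hX.nearestDist_le_iff i le_rfl, hX.count_origin] at h
  simp at h

theorem nearestDist_mono (hX : IsRegularConfiguration X) : Monotone (nearestDist X) := by
  intro i j hij
  rw [hX.nearestDist_le_iff i (nearestDist_nonneg X j)]
  refine le_trans ?_ ((hX.nearestDist_le_iff j (nearestDist_nonneg X j)).1 le_rfl)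
  exact_mod_cast Nat.succ_le_succ hij

theorem channelCoeff_pos (hX : IsRegularConfiguration X) {c α : ℝ} (hc : 0 < c) (i : ℕ) : 0 < channelCoeff c α X i :=
  mul_pos hc (Real.rpow_pos_of_pos (hX.nearestDist_pos i) _)

theorem channelCoeff_antitone (hX : IsRegularConfiguration X) {c α : ℝ} (hc : 0 < c) (hα : 0 < α) :
    Antitone (channelCoeff c α X) := fun i j hij =>
  mul_le_mul_of_nonneg_left (Real.rpow_le_rpow_of_nonpos (hX.nearestDist_pos i)
    (hX.nearestDist_mono hij) (by linarith)) hc.le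

/-- Raising to the power `α` turns `A` into `2 ^ Rmin` and distances into reciprocals of channel
coefficients, up to the common factor `c`. The same holds for two links, with `c ^ 2`. -/
theorem optimalNumLinks_eq_one_iff (hX : IsRegularConfiguration X)
    {c α Rmin A : ℝ} (hc : 0 < c) (hα : 0 < α) (hRmin : 0 < Rmin)
    (hA : A = (2 : ℝ) ^ (Rmin / α)) :
    optimalNumLinks (channelCoeff c α X) Rmin = 1 ↔ A * nearestDist X 0 ≤ nearestDist X 1 := by
  rw [_root_.optimalNumLinks_eq_one_iff (hX.channelCoeff_pos hc)
    (hX.channelCoeff_antitone hc hα) hRmin]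
  have h0 := hX.nearestDist_pos 0
  have h1 := hX.nearestDist_pos 1
  have hA0 : 0 < A := hA ▸ by positivity
  have hAα : A ^ α = 2 ^ Rmin := by
    rw [hA, ← Real.rpow_mul zero_le_two, div_mul_cancel₀ _ hα.ne']
  rw [← Real.rpow_le_rpow_iff (by positivity) h1.le hα, Real.mul_rpow hA0.le h0.le, hAα,
    channelCoeff, channelCoeff, Real.rpow_neg h0.le, Real.rpow_neg h1.le]
  have h0' := Real.rpow_pos_of_pos h0 α
  have h1' := Real.rpow_pos_of_pos h1 α
  generalize nearestDist X 0 ^ α = x at *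
  generalize nearestDist X 1 ^ α = y at *
  rw [show (2 : ℝ) ^ Rmin / (c * x⁻¹) = 2 ^ Rmin * x / c by field_simp,
    show 1 / (c * y⁻¹) = y / c by field_simp, div_le_div_iff_of_pos_right hc]

theorem optimalNumLinks_eq_two_iff (hX : IsRegularConfiguration X)
    {c α Rmin A : ℝ} (hc : 0 < c) (hα : 0 < α) (hRmin : 0 < Rmin)
    (hA : A = (2 : ℝ) ^ (Rmin / α)) :
    optimalNumLinks (channelCoeff c α X) Rmin = 2 ↔
      A * (nearestDist X 0 * nearestDist X 1) ≤ nearestDist X 2 ^ 2 ∧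
        ¬ A * nearestDist X 0 ≤ nearestDist X 1 := by
  rw [← hX.optimalNumLinks_eq_one_iff hc hα hRmin hA,
    _root_.optimalNumLinks_eq_two_iff (hX.channelCoeff_pos hc)
    (hX.channelCoeff_antitone hc hα) hRmin, _root_.optimalNumLinks_eq_one_iff
    (hX.channelCoeff_pos hc) (hX.channelCoeff_antitone hc hα) hRmin]
  refine and_congr_left' ?_
  have h0 := hX.nearestDist_pos 0
  have h1 := hX.nearestDist_pos 1
  have h2 := hX.nearestDist_pos 2
  have hA0 : 0 < A := hA ▸ by positivity
  have hAα : A ^ α = 2 ^ Rmin := by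
    rw [hA, ← Real.rpow_mul zero_le_two, div_mul_cancel₀ _ hα.ne']
  rw [iff_comm, ← Real.rpow_le_rpow_iff (by positivity) (by positivity) hα,
    Real.mul_rpow hA0.le (by positivity), Real.mul_rpow h0.le h1.le, hAα, sq (nearestDist X 2),
    Real.mul_rpow h2.le h2.le,
    channelCoeff, channelCoeff, channelCoeff, Real.rpow_neg h0.le, Real.rpow_neg h1.le,
    Real.rpow_neg h2.le]
  have h0' := Real.rpow_pos_of_pos h0 α
  have h1' := Real.rpow_pos_of_pos h1 α
  have h2' := Real.rpow_pos_of_pos h2 α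
  generalize nearestDist X 0 ^ α = x at *
  generalize nearestDist X 1 ^ α = y at *
  generalize nearestDist X 2 ^ α = z at *
  rw [show (2 : ℝ) ^ Rmin / (c * x⁻¹ * (c * y⁻¹)) = 2 ^ Rmin * (x * y) / c ^ 2 by field_simp,
    show (1 / (c * z⁻¹)) ^ 2 = z * z / c ^ 2 by field_simp,
    div_le_div_iff_of_pos_right (by positivity)]

end IsRegularConfiguration

/-! ### The law of the first three points of a unit-rate Poisson process. -/

section

open Set Real

theorem lintegral_Ioc_of_hasDerivAt {f F : ℝ → ℝ} {a b : ℝ} (hab : a ≤ b)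
    (hF : ∀ x ∈ Icc a b, HasDerivAt F (f x) x) (hf : ContinuousOn f (Icc a b))
    (hf0 : ∀ x ∈ Ioc a b, 0 ≤ f x) :
    ∫⁻ x in Ioc a b, ENNReal.ofReal (f x) = ENNReal.ofReal (F b - F a) := by
  have hint : IntervalIntegrable f volume a b :=
    ContinuousOn.intervalIntegrable (by rwa [uIcc_of_le hab])
  rw [← ofReal_integral_eq_lintegral_ofReal hint.1 (ae_restrict_of_forall_mem measurableSet_Ioc hf0),
    ← intervalIntegral.integral_of_le hab, intervalIntegral.integral_eq_sub_of_hasDerivAt _ hint]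
  rwa [uIcc_of_le hab]

theorem lintegral_Ioi_of_hasDerivAt {f F : ℝ → ℝ} {a l : ℝ}
    (hF : ∀ x ∈ Ici a, HasDerivAt F (f x) x) (hf0 : ∀ x ∈ Ioi a, 0 ≤ f x)
    (hl : Filter.Tendsto F Filter.atTop (nhds l)) :
    ∫⁻ x in Ioi a, ENNReal.ofReal (f x) = ENNReal.ofReal (l - F a) := by
  rw [← ofReal_integral_eq_lintegral_ofReal (integrableOn_Ioi_deriv_of_nonneg' hF hf0 hl)
    (ae_restrict_of_forall_mem measurableSet_Ioi hf0),
    integral_Ioi_of_hasDerivAt_of_nonneg' hF hf0 hl]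

theorem hasDerivAt_neg_exp_neg (x : ℝ) : HasDerivAt (fun z => -exp (-z)) (exp (-x)) x := by
  simpa using ((hasDerivAt_neg x).exp).fun_neg

theorem lintegral_exp_neg_Ioi (t : ℝ) :
    ∫⁻ z in Ioi t, ENNReal.ofReal (exp (-z)) = ENNReal.ofReal (exp (-t)) := by
  have hF : ∀ x ∈ Ici t, HasDerivAt (fun z => -exp (-z)) (exp (-x)) x := fun x _ =>
    hasDerivAt_neg_exp_neg x
  have hl : Filter.Tendsto (fun z : ℝ => -exp (-z)) Filter.atTop (nhds 0) := by
    simpa using Real.tendsto_exp_neg_atTop_nhds_zero.neg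
  rw [lintegral_Ioi_of_hasDerivAt hF (fun x _ => (exp_pos _).le) hl]
  simp

theorem lintegral_id_mul_exp_neg_mul_Ioi {m : ℝ} (hm : 0 < m) :
    ∫⁻ y in Ioi 0, ENNReal.ofReal (y * exp (-(m * y))) = ENNReal.ofReal (1 / m ^ 2) := by
  have hF : ∀ x ∈ Ici (0 : ℝ), HasDerivAt (fun y => -((m * y + 1) * exp (-(m * y))) / m ^ 2)
      (x * exp (-(m * x))) x := fun x _ => by
    have h1 : HasDerivAt (fun y : ℝ => m * y) m x := by
      simpa using (hasDerivAt_id x).const_mul m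
    refine (((h1.add_const 1).fun_mul h1.fun_neg.exp).fun_neg.div_const (m ^ 2)).congr_deriv ?_
    field_simp
    ring
  have hl : Filter.Tendsto (fun y : ℝ => -((m * y + 1) * exp (-(m * y))) / m ^ 2)
      Filter.atTop (nhds 0) := by
    have h1 : Filter.Tendsto (fun x : ℝ => (x + 1) * exp (-x)) Filter.atTop (nhds 0) := by
      simpa [add_mul] using (tendsto_pow_mul_exp_neg_atTop_nhds_zero 1).add
        (tendsto_pow_mul_exp_neg_atTop_nhds_zero 0)
    have h2 := h1.comp (Filter.tendsto_id.const_mul_atTop hm)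
    simpa using h2.neg.div_const (m ^ 2)
  rw [lintegral_Ioi_of_hasDerivAt hF (fun x hx => mul_nonneg (le_of_lt hx) (exp_pos _).le) hl]
  congr 1
  simp [neg_div]

/-- The joint density of `(u₀ / u₁, u₁, u₂)` for the first three points `u₀ < u₁ < u₂` of a Poisson
process of unit rate on the half-line, where the first coordinate lives on `(0, 1]` and the second
one on `(0, ∞)`. -/
noncomputable def ratioDensity (p : ℝ × ℝ × ℝ) : ENNReal :=
  {q : ℝ × ℝ × ℝ | q.2.1 < q.2.2}.indicator
    (fun q => ENNReal.ofReal q.2.1 * ENNReal.ofReal (exp (-q.2.2))) p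

/-- The joint law of the first three points of a Poisson process of unit rate on the half-line. -/
noncomputable def firstThreeLaw : Measure (ℝ × ℝ × ℝ) :=
  (((volume.restrict (Ioc (0 : ℝ) 1)).prod ((volume.restrict (Ioi (0 : ℝ))).prod
    (volume : Measure ℝ))).withDensity ratioDensity).map (fun p => (p.1 * p.2.1, p.2.1, p.2.2))

theorem measurable_ratioDensity : Measurable ratioDensity := by
  refine Measurable.indicator (by fun_prop) ?_
  exact measurableSet_lt (by fun_prop) (by fun_prop)

theorem measurable_indicator_ratioDensity {E : Set (ℝ × ℝ × ℝ)} (hE : MeasurableSet E) :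
    Measurable (((fun p : ℝ × ℝ × ℝ => (p.1 * p.2.1, p.2.1, p.2.2)) ⁻¹' E).indicator
      ratioDensity) :=
  measurable_ratioDensity.indicator (hE.preimage (by fun_prop))

/-- The factor `y` is the Jacobian of `(s, y, z) ↦ (s * y, y, z)`. Having `s` outermost suits events
that are simple once the ratio is fixed; the swapped order suits lower boxes. -/
theorem firstThreeLaw_apply {E : Set (ℝ × ℝ × ℝ)} (hE : MeasurableSet E) :
    firstThreeLaw E = ∫⁻ s in Ioc (0 : ℝ) 1, ∫⁻ y in Ioi (0 : ℝ),
      ENNReal.ofReal y * ∫⁻ z in {z | y < z ∧ (s * y, y, z) ∈ E}, ENNReal.ofReal (exp (-z)) := by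
  have hT : Measurable (fun p : ℝ × ℝ × ℝ => (p.1 * p.2.1, p.2.1, p.2.2)) := by fun_prop
  have hm := measurable_indicator_ratioDensity hE
  rw [firstThreeLaw, Measure.map_apply hT hE, withDensity_apply _ (hE.preimage hT),
    ← lintegral_indicator (hE.preimage hT), lintegral_prod _ hm.aemeasurable]
  refine lintegral_congr fun s => ?_
  rw [lintegral_prod (fun q => ((fun p : ℝ × ℝ × ℝ => (p.1 * p.2.1, p.2.1, p.2.2)) ⁻¹' E).indicator
    ratioDensity (s, q)) (hm.comp measurable_prodMk_left).aemeasurable]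
  refine lintegral_congr fun y => ?_
  have hset : MeasurableSet {z | y < z ∧ (s * y, y, z) ∈ E} :=
    measurableSet_Ioi.inter (hE.preimage (f := fun z => (s * y, y, z)) (by fun_prop))
  rw [← lintegral_const_mul _ (by fun_prop), ← lintegral_indicator hset]
  refine lintegral_congr fun z => ?_
  by_cases h1 : y < z <;> by_cases h2 : (s * y, y, z) ∈ E <;>
    simp [ratioDensity, indicator, h1, h2]

theorem firstThreeLaw_apply_swap {E : Set (ℝ × ℝ × ℝ)} (hE : MeasurableSet E) :
    firstThreeLaw E = ∫⁻ y in Ioi (0 : ℝ), ∫⁻ s in Ioc (0 : ℝ) 1,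
      ENNReal.ofReal y * ∫⁻ z in {z | y < z ∧ (s * y, y, z) ∈ E}, ENNReal.ofReal (exp (-z)) := by
  rw [firstThreeLaw_apply hE, lintegral_lintegral_swap]
  have hset : MeasurableSet {p : (ℝ × ℝ) × ℝ | p.1.2 < p.2 ∧ (p.1.1 * p.1.2, p.1.2, p.2) ∈ E} :=
    (measurableSet_lt (f := fun p : (ℝ × ℝ) × ℝ => p.1.2) (g := Prod.snd)
      (by fun_prop) (by fun_prop)).inter
      (hE.preimage (f := fun p : (ℝ × ℝ) × ℝ => (p.1.1 * p.1.2, p.1.2, p.2)) (by fun_prop))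
  have h : Measurable fun p : ℝ × ℝ => ∫⁻ z, {p : (ℝ × ℝ) × ℝ | p.1.2 < p.2 ∧
      (p.1.1 * p.1.2, p.1.2, p.2) ∈ E}.indicator (fun q => ENNReal.ofReal (exp (-q.2))) (p, z) :=
    Measurable.lintegral_prod_right' (Measurable.indicator (by fun_prop) hset)
  have h' : (Function.uncurry fun s y : ℝ => ENNReal.ofReal y *
      ∫⁻ z in {z | y < z ∧ (s * y, y, z) ∈ E}, ENNReal.ofReal (exp (-z))) =
      fun p : ℝ × ℝ => ENNReal.ofReal p.2 * ∫⁻ z, {p : (ℝ × ℝ) × ℝ | p.1.2 < p.2 ∧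
      (p.1.1 * p.1.2, p.1.2, p.2) ∈ E}.indicator (fun q => ENNReal.ofReal (exp (-q.2))) (p, z) := by
    funext p
    obtain ⟨s, y⟩ := p
    have hset' : MeasurableSet {z | y < z ∧ (s * y, y, z) ∈ E} :=
      measurableSet_Ioi.inter (hE.preimage (f := fun z => (s * y, y, z)) (by fun_prop))
    simp only [Function.uncurry]
    rw [← lintegral_indicator hset']
    rfl
  rw [h']
  exact ((ENNReal.measurable_ofReal.comp measurable_snd).mul h).aemeasurable

theorem lintegral_mul_exp_neg_of_le {y k : ℝ} (hy : 0 < y) :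
    ENNReal.ofReal y * ∫⁻ z in {z | y < z ∧ k * y ≤ z}, ENNReal.ofReal (exp (-z)) =
      ENNReal.ofReal (y * exp (-(max 1 k * y))) := by
  have hae : {z | y < z ∧ k * y ≤ z} =ᵐ[volume] Ioi (max 1 k * y) := by
    rw [max_mul_of_nonneg _ _ hy.le, one_mul, ← Ioi_inter_Ioi]
    exact (ae_eq_refl (Ioi y)).inter (Ioi_ae_eq_Ici (a := k * y)).symm
  rw [setLIntegral_congr hae, lintegral_exp_neg_Ioi, ENNReal.ofReal_mul hy.le]

/-- This is the probability of `u₂ ≥ k * u₁`: the two lower bounds on `z` merge into `max 1 k * y`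
up to a null set. Taking `k = 1` gives total mass one. -/
theorem lintegral_lintegral_mul_exp_neg_of_le (k : ℝ) :
    ∫⁻ y in Ioi (0 : ℝ), ENNReal.ofReal y *
      ∫⁻ z in {z | y < z ∧ k * y ≤ z}, ENNReal.ofReal (exp (-z)) =
      ENNReal.ofReal (1 / max 1 k ^ 2) := by
  rw [← lintegral_id_mul_exp_neg_mul_Ioi (m := max 1 k) (by positivity)]
  exact setLIntegral_congr_fun measurableSet_Ioi fun y hy => lintegral_mul_exp_neg_of_le hy

theorem measurableSet_mul_fst_le (B : ℝ) :
    MeasurableSet {q : ℝ × ℝ × ℝ | B * q.1 ≤ q.2.1} :=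
  measurableSet_le (by fun_prop) (by fun_prop)

theorem measurableSet_mul_mul_le_sq (B : ℝ) :
    MeasurableSet {q : ℝ × ℝ × ℝ | B * (q.1 * q.2.1) ≤ q.2.2 ^ 2} :=
  measurableSet_le (by fun_prop) (by fun_prop)

/-- The event is `s ≤ 1 / B` for the uniform ratio `s`. -/
theorem firstThreeLaw_mul_fst_le {B : ℝ} (hB : 1 ≤ B) :
    firstThreeLaw {q | B * q.1 ≤ q.2.1} = ENNReal.ofReal (1 / B) := by
  have hB0 : 0 < B := by linarith
  rw [firstThreeLaw_apply (measurableSet_mul_fst_le B)]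
  have h : ∀ s ∈ Ioc (0 : ℝ) 1, ∫⁻ y in Ioi (0 : ℝ), ENNReal.ofReal y *
      ∫⁻ z in {z | y < z ∧ (s * y, y, z) ∈ {q : ℝ × ℝ × ℝ | B * q.1 ≤ q.2.1}},
        ENNReal.ofReal (exp (-z)) = (Iic (1 / B)).indicator (fun _ => 1) s := by
    intro s _
    by_cases hs : s ≤ 1 / B
    · rw [indicator_of_mem (show s ∈ Iic (1 / B) from hs)]
      have h1 := lintegral_lintegral_mul_exp_neg_of_le 1
      rw [max_self, one_pow, div_one, ENNReal.ofReal_one] at h1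
      rw [← h1]
      refine setLIntegral_congr_fun measurableSet_Ioi fun y hy => ?_
      have hy : 0 < y := hy
      rw [le_div_iff₀ hB0] at hs
      simp only [mem_ofPred_eq]
      congr 3
      ext z
      simp only [mem_ofPred_eq, and_congr_right_iff]
      intro hz
      exact iff_of_true (by nlinarith) (by linarith)
    · rw [indicator_of_notMem (show s ∉ Iic (1 / B) from hs)]
      have hy : ∀ y ∈ Ioi (0 : ℝ), ENNReal.ofReal y * ∫⁻ z in {z | y < z ∧ (s * y, y, z) ∈
          {q : ℝ × ℝ × ℝ | B * q.1 ≤ q.2.1}}, ENNReal.ofReal (exp (-z)) = 0 := by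
        intro y hy
        have hy : 0 < y := hy
        rw [not_le, div_lt_iff₀ hB0] at hs
        have : ¬ B * (s * y) ≤ y := by
          rw [not_le]; nlinarith
        simp [this]
      rw [setLIntegral_congr_fun measurableSet_Ioi hy, lintegral_zero]
  rw [setLIntegral_congr_fun measurableSet_Ioc h, lintegral_indicator measurableSet_Iic,
    setLIntegral_one, Measure.restrict_apply measurableSet_Iic, inter_comm, Ioc_inter_Iic,
    inf_eq_right.2 (by rw [div_le_one hB0]; exact hB), Real.volume_Ioc, sub_zero]

/-- For fixed `s` the event is `√(B * s) * y ≤ z`, of probability `1 / max 1 (B * s)`. The integral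
over `s` splits at `1 / B`, and the logarithm comes from the part above. -/
theorem firstThreeLaw_mul_mul_le_sq {B : ℝ} (hB : 1 ≤ B) :
    firstThreeLaw {q | B * (q.1 * q.2.1) ≤ q.2.2 ^ 2} =
      ENNReal.ofReal (1 / B + log B / B) := by
  have hB0 : 0 < B := by linarith
  have hB1 : 1 / B ≤ 1 := by rw [div_le_one hB0]; exact hB
  rw [firstThreeLaw_apply (measurableSet_mul_mul_le_sq B)]
  have h : ∀ s ∈ Ioc (0 : ℝ) 1, ∫⁻ y in Ioi (0 : ℝ), ENNReal.ofReal y *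
      ∫⁻ z in {z | y < z ∧ (s * y, y, z) ∈ {q : ℝ × ℝ × ℝ | B * (q.1 * q.2.1) ≤ q.2.2 ^ 2}},
        ENNReal.ofReal (exp (-z)) = ENNReal.ofReal (1 / max 1 (B * s)) := by
    intro s hs
    have hs0 : 0 ≤ B * s := mul_nonneg hB0.le hs.1.le
    have hmax : max 1 (B * s) = max 1 √(B * s) ^ 2 := by
      rcases le_total (B * s) 1 with h | h
      · rw [max_eq_left h, max_eq_left (Real.sqrt_le_one.2 h), one_pow]
      · rw [max_eq_right h, max_eq_right (Real.one_le_sqrt.2 h), Real.sq_sqrt hs0]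
    rw [hmax, ← lintegral_lintegral_mul_exp_neg_of_le]
    refine setLIntegral_congr_fun measurableSet_Ioi fun y hy => ?_
    have hy : 0 < y := hy
    simp only [mem_ofPred_eq]
    congr 3
    ext z
    simp only [mem_ofPred_eq, and_congr_right_iff]
    intro hz
    rw [← sq_le_sq₀ (by positivity) (hy.trans hz).le, mul_pow, Real.sq_sqrt hs0]
    ring_nf
  rw [setLIntegral_congr_fun measurableSet_Ioc h,
    ← Ioc_union_Ioc_eq_Ioc (show 0 ≤ 1 / B by positivity) hB1,
    lintegral_union measurableSet_Ioc (Ioc_disjoint_Ioc_of_le le_rfl)]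
  have h1 : ∀ s ∈ Ioc 0 (1 / B), ENNReal.ofReal (1 / max 1 (B * s)) = 1 := by
    intro s hs
    have := hs.2
    rw [le_div_iff₀ hB0] at this
    rw [max_eq_left (by linarith), div_one, ENNReal.ofReal_one]
  have h2 : ∀ s ∈ Ioc (1 / B) 1, ENNReal.ofReal (1 / max 1 (B * s)) =
      ENNReal.ofReal (s⁻¹ / B) := by
    intro s hs
    have := hs.1
    rw [div_lt_iff₀ hB0] at this
    rw [max_eq_right (by linarith)]
    congr 1
    rw [one_div, mul_inv, mul_comm, div_eq_mul_inv]
  have hpos : ∀ s ∈ Icc (1 / B) 1, 0 < s := fun s hs => lt_of_lt_of_le (by positivity) hs.1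
  rw [setLIntegral_congr_fun measurableSet_Ioc h1, setLIntegral_congr_fun measurableSet_Ioc h2,
    setLIntegral_one, Real.volume_Ioc, sub_zero,
    lintegral_Ioc_of_hasDerivAt (F := fun s => log s / B) hB1
      (fun s hs => (Real.hasDerivAt_log (hpos s hs).ne').div_const B)
      ((continuousOn_inv₀.mono fun s hs => (hpos s hs).ne').div_const B)
      (fun s hs => div_nonneg (inv_nonneg.2 (hpos s (Ioc_subset_Icc_self hs)).le) hB0.le),
    ← ENNReal.ofReal_add (by positivity)]
  · congr 1
    simp [Real.log_inv, neg_div]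
  · simpa [Real.log_inv, neg_div] using div_nonneg (Real.log_nonneg hB) hB0.le

instance : IsProbabilityMeasure firstThreeLaw := by
  constructor
  have h := firstThreeLaw_apply MeasurableSet.univ
  have h1 := lintegral_lintegral_mul_exp_neg_of_le 1
  have hset : ∀ y : ℝ, {z | y < z ∧ 1 * y ≤ z} = {z | y < z} := fun y => by
    ext z
    simp only [mem_ofPred_eq, one_mul, and_iff_left_iff_imp]
    exact le_of_lt
  simp only [hset] at h1
  simp only [mem_univ, and_true, h1] at h
  simpa using h

/-- The joint cumulative distribution function of the first three points. -/
theorem firstThreeLaw_Iic {a b c : ℝ} (ha : 0 ≤ a) (hab : a ≤ b) (hbc : b ≤ c) :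
    firstThreeLaw (Iic a ×ˢ (Iic b ×ˢ Iic c)) = ENNReal.ofReal
      (1 - (exp (-a) + a * exp (-b) + (a * b - a ^ 2 / 2) * exp (-c))) := by
  rw [firstThreeLaw_apply_swap (measurableSet_Iic.prod (measurableSet_Iic.prod measurableSet_Iic))]
  have hz : ∀ y ≤ c, ∫⁻ z in Ioc y c, ENNReal.ofReal (exp (-z)) =
      ENNReal.ofReal (exp (-y) - exp (-c)) := by
    intro y hy
    rw [lintegral_Ioc_of_hasDerivAt (F := fun z => -exp (-z)) hy
      (fun x _ => hasDerivAt_neg_exp_neg x) (by fun_prop)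
      (fun x _ => (exp_pos _).le)]
    congr 1
    ring
  have hmono : ∀ y ≤ c, 0 ≤ exp (-y) - exp (-c) := fun y hy => by
    rw [sub_nonneg]; gcongr
  -- The box restricts `s` to a length `min 1 (a / y)`, and the Jacobian `y` turns this into `min y
  -- a`; hence the later split at `y = a`.
  have h : ∀ y ∈ Ioi (0 : ℝ), ∫⁻ s in Ioc (0 : ℝ) 1, ENNReal.ofReal y *
      ∫⁻ z in {z | y < z ∧ (s * y, y, z) ∈ Iic a ×ˢ (Iic b ×ˢ Iic c)}, ENNReal.ofReal (exp (-z)) =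
      (Iic b).indicator (fun y => ENNReal.ofReal (min y a * (exp (-y) - exp (-c)))) y := by
    intro y hy
    have hy : 0 < y := hy
    by_cases hyb : y ≤ b
    · rw [indicator_of_mem (show y ∈ Iic b from hyb)]
      have hs : ∀ s ∈ Ioc (0 : ℝ) 1, ENNReal.ofReal y *
          ∫⁻ z in {z | y < z ∧ (s * y, y, z) ∈ Iic a ×ˢ (Iic b ×ˢ Iic c)},
            ENNReal.ofReal (exp (-z)) =
          (Iic (a / y)).indicator (fun _ => ENNReal.ofReal (y * (exp (-y) - exp (-c)))) s := by
        intro s _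
        by_cases hsa : s ≤ a / y
        · rw [indicator_of_mem (show s ∈ Iic (a / y) from hsa), ENNReal.ofReal_mul hy.le,
            ← hz y (hyb.trans hbc)]
          rw [le_div_iff₀ hy] at hsa
          congr 3
          ext z
          simp [hsa, hyb]
        · rw [indicator_of_notMem (show s ∉ Iic (a / y) from hsa)]
          rw [le_div_iff₀ hy] at hsa
          simp [hsa]
      rw [setLIntegral_congr_fun measurableSet_Ioc hs, lintegral_indicator measurableSet_Iic,
        setLIntegral_const, Measure.restrict_apply measurableSet_Iic, inter_comm, Ioc_inter_Iic,
        Real.volume_Ioc, ← ENNReal.ofReal_mul (mul_nonneg hy.le (hmono y (hyb.trans hbc)))]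
      congr 1
      have : min y a = y * min 1 (a / y) := by
        rw [mul_min_of_nonneg _ _ hy.le, mul_one, mul_div_cancel₀ _ hy.ne']
      rw [this]
      ring
    · rw [indicator_of_notMem (show y ∉ Iic b from hyb)]
      simp [hyb]
  rw [setLIntegral_congr_fun measurableSet_Ioi h, lintegral_indicator measurableSet_Iic,
    Measure.restrict_restrict measurableSet_Iic, inter_comm, Ioi_inter_Iic,
    ← Ioc_union_Ioc_eq_Ioc ha hab,
    lintegral_union measurableSet_Ioc (Ioc_disjoint_Ioc_of_le le_rfl)]
  have hle : ∀ y ∈ Ioc 0 a, ENNReal.ofReal (min y a * (exp (-y) - exp (-c))) =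
      ENNReal.ofReal (y * (exp (-y) - exp (-c))) := fun y hy => by rw [min_eq_left hy.2]
  have hge : ∀ y ∈ Ioc a b, ENNReal.ofReal (min y a * (exp (-y) - exp (-c))) =
      ENNReal.ofReal (a * (exp (-y) - exp (-c))) := fun y hy => by rw [min_eq_right hy.1.le]
  have i1 := lintegral_Ioc_of_hasDerivAt (f := fun y => y * (exp (-y) - exp (-c)))
    (F := fun y => -((y + 1) * exp (-y)) - y ^ 2 / 2 * exp (-c)) ha
    (fun x _ => by
      refine ((((hasDerivAt_id' x).add_const 1).fun_mul (hasDerivAt_neg x).exp).fun_neg.fun_sub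
        ((((hasDerivAt_id' x).fun_pow 2).div_const 2).mul_const (exp (-c)))).congr_deriv ?_
      simp
      ring) (by fun_prop)
    (fun x hx => mul_nonneg hx.1.le (hmono x (hx.2.trans (hab.trans hbc))))
  have i2 := lintegral_Ioc_of_hasDerivAt (f := fun y => a * (exp (-y) - exp (-c)))
    (F := fun y => a * (-exp (-y) - y * exp (-c))) hab
    (fun x _ => by
      refine (((hasDerivAt_neg_exp_neg x).fun_sub
        ((hasDerivAt_id' x).mul_const (exp (-c)))).const_mul a).congr_deriv ?_
      simp) (by fun_prop)
    (fun x hx => mul_nonneg ha (hmono x (hx.2.trans hbc)))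
  rw [setLIntegral_congr_fun measurableSet_Ioc hle, setLIntegral_congr_fun measurableSet_Ioc hge,
    i1, i2, ← ENNReal.ofReal_add]
  · congr 1
    simp
    ring
  -- The remaining goals are the nonnegativity of the two pieces, needed to add inside
  -- `ENNReal.ofReal`. They follow from `1 + a + a ^ 2 / 2 ≤ exp a` and `1 + x ≤ exp x`.
  · have hc' : exp (-c) ≤ exp (-a) := by gcongr; exact hab.trans hbc
    have h2 := quadratic_le_exp_of_nonneg ha
    have h3 : exp (-a) * exp a = 1 := by rw [← exp_add]; simp
    have h4 := exp_pos (-a)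
    have h5 : a ^ 2 / 2 * exp (-c) ≤ a ^ 2 / 2 * exp (-a) := by gcongr
    simp
    nlinarith
  · have h1 : exp (-b) - exp (-a) ≤ (a - b) * exp (-b) := by
      have := add_one_le_exp (b - a)
      have h3 : exp (-a) = exp (-b) * exp (b - a) := by rw [← exp_add]; ring_nf
      have h4 := exp_pos (-b)
      rw [h3]
      nlinarith
    have h2 : (b - a) * exp (-c) ≤ (b - a) * exp (-b) := by
      have := sub_nonneg.2 hab
      gcongr
    have : 0 ≤ (-exp (-b) - b * exp (-c)) - (-exp (-a) - a * exp (-c)) := by nlinarith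
    nlinarith [mul_nonneg ha this]

/-! ### Laws on ordered triples are determined by ordered boxes. -/

theorem isCountablySpanning_range_Iic_real : IsCountablySpanning (range (Iic : ℝ → Set ℝ)) := by
  refine ⟨fun n : ℕ => Iic (n : ℝ), fun n => mem_range_self _, ?_⟩
  refine eq_univ_of_forall fun x => ?_
  obtain ⟨n, hn⟩ := exists_nat_ge x
  exact mem_iUnion.2 ⟨n, hn⟩

/-- On ordered triples a bound on a later coordinate also bounds the earlier ones, so any box may be
replaced by one with ordered corners. -/
theorem measure_box_eq_min {μ : Measure (ℝ × ℝ × ℝ)}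
    (hμ : ∀ᵐ q ∂μ, 0 ≤ q.1 ∧ q.1 ≤ q.2.1 ∧ q.2.1 ≤ q.2.2) (a b c : ℝ) :
    μ (Iic a ×ˢ (Iic b ×ˢ Iic c)) =
      μ (Iic (min a (min b c)) ×ˢ (Iic (min b c) ×ˢ Iic c)) := by
  refine measure_congr ?_
  filter_upwards [hμ] with q hq
  refine propext ⟨fun h => ?_, fun h => ?_⟩
  · obtain ⟨h1, h2, h3⟩ := h
    exact ⟨le_min h1 (le_min (hq.2.1.trans h2) (hq.2.1.trans (hq.2.2.trans h3))),
      le_min h2 (hq.2.2.trans h3), h3⟩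
  · obtain ⟨h1, h2, h3⟩ := h
    exact ⟨show q.1 ≤ a from le_trans h1 (min_le_left _ _),
      show q.2.1 ≤ b from le_trans h2 (min_le_left _ _), h3⟩

/-- Two laws on ordered nonnegative triples agree if they do so on ordered lower boxes. -/
theorem measure_ext_of_ordered_boxes {μ ν : Measure (ℝ × ℝ × ℝ)} [IsProbabilityMeasure μ]
    [IsProbabilityMeasure ν] (hμ : ∀ᵐ q ∂μ, 0 ≤ q.1 ∧ q.1 ≤ q.2.1 ∧ q.2.1 ≤ q.2.2)
    (hν : ∀ᵐ q ∂ν, 0 ≤ q.1 ∧ q.1 ≤ q.2.1 ∧ q.2.1 ≤ q.2.2)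
    (h : ∀ a b c, 0 ≤ a → a ≤ b → b ≤ c →
      μ (Iic a ×ˢ (Iic b ×ˢ Iic c)) = ν (Iic a ×ˢ (Iic b ×ˢ Iic c))) : μ = ν := by
  have hneg : ∀ (ρ : Measure (ℝ × ℝ × ℝ)),
      (∀ᵐ q ∂ρ, 0 ≤ q.1 ∧ q.1 ≤ q.2.1 ∧ q.2.1 ≤ q.2.2) → ∀ a b c, a < 0 →
      ρ (Iic a ×ˢ (Iic b ×ˢ Iic c)) = 0 := by
    intro ρ hρ a b c ha
    rw [ae_iff] at hρ
    refine measure_mono_null (fun q hq => ?_) hρ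
    exact fun hq' => absurd (hq'.1.trans hq.1) (not_le.2 ha)
  have hgen : borel ℝ = MeasurableSpace.generateFrom (range Iic) := borel_eq_generateFrom_Iic ℝ
  have hR : (Real.measurableSpace : MeasurableSpace ℝ) =
      MeasurableSpace.generateFrom (range Iic) := by
    rw [← hgen]; exact BorelSpace.measurable_eq
  have hC := isCountablySpanning_range_Iic_real
  have hgen2 : (inferInstance : MeasurableSpace (ℝ × ℝ × ℝ)) = MeasurableSpace.generateFrom
      (image2 (· ×ˢ ·) (range Iic) (image2 (· ×ˢ ·) (range Iic) (range Iic))) := by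
    rw [← generateFrom_prod_eq hC (hC.prod hC), ← generateFrom_prod_eq hC hC, ← hR]
  refine ext_of_generate_finite _ hgen2 (isPiSystem_Iic.prod (isPiSystem_Iic.prod isPiSystem_Iic))
    ?_ (by simp)
  rintro _ ⟨_, ⟨a, rfl⟩, _, ⟨_, ⟨b, rfl⟩, _, ⟨c, rfl⟩, rfl⟩, rfl⟩
  change μ (Iic a ×ˢ (Iic b ×ˢ Iic c)) = ν (Iic a ×ˢ (Iic b ×ˢ Iic c))
  rw [measure_box_eq_min hμ, measure_box_eq_min hν]
  rcases lt_or_ge (min a (min b c)) 0 with h0 | h0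
  · rw [hneg μ hμ _ _ _ h0, hneg ν hν _ _ _ h0]
  · exact h _ _ _ h0 (min_le_right _ _) (min_le_right _ _)

theorem firstThreeLaw_ordered : ∀ᵐ q ∂firstThreeLaw, 0 ≤ q.1 ∧ q.1 ≤ q.2.1 ∧ q.2.1 ≤ q.2.2 := by
  have hm : MeasurableSet {q : ℝ × ℝ × ℝ | 0 ≤ q.1 ∧ q.1 ≤ q.2.1 ∧ q.2.1 ≤ q.2.2} :=
    (measurableSet_le measurable_const measurable_fst).inter
      ((measurableSet_le measurable_fst (by fun_prop)).inter
        (measurableSet_le (f := fun q : ℝ × ℝ × ℝ => q.2.1) (g := fun q => q.2.2)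
          (by fun_prop) (by fun_prop)))
  rw [ae_iff]
  change firstThreeLaw {q : ℝ × ℝ × ℝ | 0 ≤ q.1 ∧ q.1 ≤ q.2.1 ∧ q.2.1 ≤ q.2.2}ᶜ = 0
  rw [firstThreeLaw_apply hm.compl]
  have h : ∀ s ∈ Ioc (0 : ℝ) 1, ∫⁻ y in Ioi (0 : ℝ), ENNReal.ofReal y *
      ∫⁻ z in {z | y < z ∧ (s * y, y, z) ∈
        {q : ℝ × ℝ × ℝ | 0 ≤ q.1 ∧ q.1 ≤ q.2.1 ∧ q.2.1 ≤ q.2.2}ᶜ},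
        ENNReal.ofReal (exp (-z)) = 0 := by
    intro s hs
    have h' : ∀ y ∈ Ioi (0 : ℝ), ENNReal.ofReal y * ∫⁻ z in {z | y < z ∧ (s * y, y, z) ∈
        {q : ℝ × ℝ × ℝ | 0 ≤ q.1 ∧ q.1 ≤ q.2.1 ∧ q.2.1 ≤ q.2.2}ᶜ},
        ENNReal.ofReal (exp (-z)) = 0 := by
      intro y hy
      have hy : 0 < y := hy
      have : {z | y < z ∧ (s * y, y, z) ∈
          {q : ℝ × ℝ × ℝ | 0 ≤ q.1 ∧ q.1 ≤ q.2.1 ∧ q.2.1 ≤ q.2.2}ᶜ} = ∅ := by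
        refine eq_empty_of_forall_notMem fun z hz => hz.2 ⟨mul_nonneg hs.1.le hy.le, ?_, hz.1.le⟩
        exact mul_le_of_le_one_left hy.le hs.2
      rw [this]
      simp
    rw [setLIntegral_congr_fun measurableSet_Ioi h', lintegral_zero]
  rw [setLIntegral_congr_fun measurableSet_Ioc h, lintegral_zero]

/-! ### Poisson counts in concentric discs and annuli. -/

/-- The closed disc around the origin in which a homogeneous Poisson process of intensity `lam` has
`t` points on average. -/
noncomputable def meanDisc (lam t : ℝ) : Set Plane := Metric.closedBall 0 √(t / (π * lam))

theorem measurableSet_meanDisc (lam t : ℝ) : MeasurableSet (meanDisc lam t) :=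
  Metric.isClosed_closedBall.measurableSet

theorem isBounded_meanDisc (lam t : ℝ) : Bornology.IsBounded (meanDisc lam t) :=
  Metric.isBounded_closedBall

theorem meanDisc_mono {lam : ℝ} (hlam : 0 < lam) {s t : ℝ} (h : s ≤ t) :
    meanDisc lam s ⊆ meanDisc lam t :=
  Metric.closedBall_subset_closedBall (Real.sqrt_le_sqrt (by gcongr))

theorem volume_real_meanDisc {lam : ℝ} (hlam : 0 < lam) {t : ℝ} (ht : 0 ≤ t) :
    lam * volume.real (meanDisc lam t) = t := by
  rw [meanDisc, Measure.real, EuclideanSpace.volume_closedBall_fin_two, ENNReal.toReal_mul,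
    ENNReal.toReal_pow, ENNReal.toReal_ofReal (Real.sqrt_nonneg _),
    ENNReal.toReal_ofReal pi_pos.le, Real.sq_sqrt (by positivity)]
  field_simp

theorem volume_real_meanDisc_diff {lam : ℝ} (hlam : 0 < lam) {s t : ℝ} (hs : 0 ≤ s) (h : s ≤ t) :
    lam * volume.real (meanDisc lam t \ meanDisc lam s) = t - s := by
  rw [measureReal_sdiff (meanDisc_mono hlam h) (measurableSet_meanDisc lam s)
    (isBounded_meanDisc lam t).measure_lt_top.ne, mul_sub, volume_real_meanDisc hlam hs,
    volume_real_meanDisc hlam (hs.trans h)]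

namespace IsHomogeneousPoissonProcess

variable {Ω : Type*} [MeasurableSpace Ω] {P : Measure Ω} {Φ : Ω → Set Plane} {lam : ℝ}

theorem measurableSet_count (hΦ : IsHomogeneousPoissonProcess P Φ lam) {S : Set Plane}
    (hS : MeasurableSet S) (K : Set ℕ∞) : MeasurableSet {ω | pointCount (Φ ω) S ∈ K} :=
  hΦ.measurable_count S hS (MeasurableSet.of_discrete (s := K))

theorem real_forall_count_eq (hΦ : IsHomogeneousPoissonProcess P Φ lam) {n : ℕ}
    {S : Fin n → Set Plane} (hS : ∀ i, MeasurableSet (S i))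
    (hb : ∀ i, Bornology.IsBounded (S i)) (hd : Pairwise (fun i j => Disjoint (S i) (S j)))
    (k : Fin n → ℕ) :
    P.real {ω | ∀ i, pointCount (Φ ω) (S i) = (k i : ℕ∞)} =
      ∏ i, ((lam * volume.real (S i)) ^ k i / ((k i).factorial : ℝ) *
        Real.exp (-(lam * volume.real (S i)))) := by
  have h := (hΦ.indep_count n S hS hd).measure_inter_preimage_eq_mul Finset.univ
    (sets := fun i => {(k i : ℕ∞)}) (fun i _ => MeasurableSet.of_discrete)
  have hset : {ω | ∀ i, pointCount (Φ ω) (S i) = (k i : ℕ∞)} =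
      ⋂ i ∈ Finset.univ, (fun ω => pointCount (Φ ω) (S i)) ⁻¹' {(k i : ℕ∞)} := by
    ext ω; simp
  rw [hset, Measure.real, h, ENNReal.toReal_prod]
  exact Finset.prod_congr rfl fun i _ => hΦ.count_law (S i) (hS i) (hb i) (k i)

/-- The disc and the annulus are disjoint, with mean counts `a` and `b - a`, so the exponential
factors combine to `exp (-b)`. -/
theorem real_two_discs (hΦ : IsHomogeneousPoissonProcess P Φ lam) (hlam : 0 < lam) {a b : ℝ}
    (ha : 0 ≤ a) (hab : a ≤ b) (i j : ℕ) :
    P.real {ω | pointCount (Φ ω) (meanDisc lam a) = i ∧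
      pointCount (Φ ω) (meanDisc lam b \ meanDisc lam a) = j} =
      a ^ i / i.factorial * ((b - a) ^ j / j.factorial) * Real.exp (-b) := by
  have h := hΦ.real_forall_count_eq (S := ![meanDisc lam a, meanDisc lam b \ meanDisc lam a])
    (by
      intro l
      fin_cases l
      · exact measurableSet_meanDisc lam a
      · exact (measurableSet_meanDisc lam b).diff (measurableSet_meanDisc lam a))
    (by
      intro l
      fin_cases l
      · exact isBounded_meanDisc lam a
      · exact (isBounded_meanDisc lam b).subset sdiff_subset)
    (by
      intro l l' hl
      fin_cases l <;> fin_cases l' <;> first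
        | exact absurd rfl hl
        | exact disjoint_sdiff_self_right
        | exact disjoint_sdiff_self_left) ![i, j]
  simp only [Fin.forall_fin_two, Fin.prod_univ_two, Matrix.cons_val_zero, Matrix.cons_val_one,
    volume_real_meanDisc hlam ha, volume_real_meanDisc_diff hlam ha hab] at h
  rw [h, show -b = -a + -(b - a) by ring, Real.exp_add]
  ring

theorem real_three_discs (hΦ : IsHomogeneousPoissonProcess P Φ lam) (hlam : 0 < lam) {a b c : ℝ}
    (ha : 0 ≤ a) (hab : a ≤ b) (hbc : b ≤ c) (i j k : ℕ) :
    P.real {ω | pointCount (Φ ω) (meanDisc lam a) = i ∧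
      pointCount (Φ ω) (meanDisc lam b \ meanDisc lam a) = j ∧
      pointCount (Φ ω) (meanDisc lam c \ meanDisc lam b) = k} =
      a ^ i / i.factorial * ((b - a) ^ j / j.factorial) * ((c - b) ^ k / k.factorial) *
        Real.exp (-c) := by
  have hsub := meanDisc_mono hlam hab
  have h := hΦ.real_forall_count_eq (S := ![meanDisc lam a, meanDisc lam b \ meanDisc lam a,
      meanDisc lam c \ meanDisc lam b])
    (by
      intro l
      fin_cases l
      · exact measurableSet_meanDisc lam a
      · exact (measurableSet_meanDisc lam b).diff (measurableSet_meanDisc lam a)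
      · exact (measurableSet_meanDisc lam c).diff (measurableSet_meanDisc lam b))
    (by
      intro l
      fin_cases l
      · exact isBounded_meanDisc lam a
      · exact (isBounded_meanDisc lam b).subset sdiff_subset
      · exact (isBounded_meanDisc lam c).subset sdiff_subset)
    (by
      intro l l' hl
      fin_cases l <;> fin_cases l' <;> first
        | exact absurd rfl hl
        | exact disjoint_sdiff_self_right
        | exact disjoint_sdiff_self_left
        | exact disjoint_sdiff_self_right.mono_left hsub
        | exact disjoint_sdiff_self_left.mono_right hsub
        | exact disjoint_sdiff_self_right.mono_left sdiff_subset
        | exact disjoint_sdiff_self_left.mono_right sdiff_subset) ![i, j, k]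
  have hforall : ∀ p : Fin 3 → Prop, (∀ l, p l) ↔ p 0 ∧ p 1 ∧ p 2 := fun p => by
    simp [Fin.forall_fin_succ]
  simp only [hforall, Fin.prod_univ_three, Matrix.cons_val_zero, Matrix.cons_val_one,
    Matrix.cons_val, volume_real_meanDisc hlam ha, volume_real_meanDisc_diff hlam ha hab,
    volume_real_meanDisc_diff hlam (ha.trans hab) hbc] at h
  rw [h, show -c = -a + -(b - a) + -(c - b) by ring, Real.exp_add, Real.exp_add]
  ring

/-- The joint cumulative distribution function of the first three points, in terms of counts. -/
theorem real_counts_ge (hΦ : IsHomogeneousPoissonProcess P Φ lam) [IsProbabilityMeasure P]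
    (hlam : 0 < lam) {a b c : ℝ} (ha : 0 ≤ a) (hab : a ≤ b) (hbc : b ≤ c) :
    P.real {ω | 1 ≤ pointCount (Φ ω) (meanDisc lam a) ∧ 2 ≤ pointCount (Φ ω) (meanDisc lam b) ∧
      3 ≤ pointCount (Φ ω) (meanDisc lam c)} =
      1 - (Real.exp (-a) + a * Real.exp (-b) + (a * b - a ^ 2 / 2) * Real.exp (-c)) := by
  set X : Ω → ℕ∞ := fun ω => pointCount (Φ ω) (meanDisc lam a)
  set Y : Ω → ℕ∞ := fun ω => pointCount (Φ ω) (meanDisc lam b \ meanDisc lam a)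
  set Z : Ω → ℕ∞ := fun ω => pointCount (Φ ω) (meanDisc lam c \ meanDisc lam b)
  have hX : Measurable X := hΦ.measurable_count _ (measurableSet_meanDisc lam a)
  have hY : Measurable Y := hΦ.measurable_count _
    ((measurableSet_meanDisc lam b).diff (measurableSet_meanDisc lam a))
  have hZ : Measurable Z := hΦ.measurable_count _
    ((measurableSet_meanDisc lam c).diff (measurableSet_meanDisc lam b))
  have hXYZ : ∀ i j k : ℕ∞, MeasurableSet {ω | X ω = i ∧ Y ω = j ∧ Z ω = k} := fun i j k =>
    (hX (measurableSet_singleton i)).inter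
      ((hY (measurableSet_singleton j)).inter (hZ (measurableSet_singleton k)))
  have hXY : ∀ i j : ℕ∞, MeasurableSet {ω | X ω = i ∧ Y ω = j} := fun i j =>
    (hX (measurableSet_singleton i)).inter (hY (measurableSet_singleton j))
  have hXm : MeasurableSet {ω | X ω = 0} := hX (measurableSet_singleton 0)
  have hb : ∀ ω, pointCount (Φ ω) (meanDisc lam b) = X ω + Y ω := fun ω =>
    pointCount_add_diff _ (meanDisc_mono hlam hab)
  have hc : ∀ ω, pointCount (Φ ω) (meanDisc lam c) = X ω + Y ω + Z ω := fun ω => by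
    rw [← hb, pointCount_add_diff _ (meanDisc_mono hlam hbc)]
  -- The complement splits into four disjoint patterns of counts in the disc and the two annuli. The
  -- last two produce the coefficient `a * (b - a) + a ^ 2 / 2 = a * b - a ^ 2 / 2`.
  have harith : ∀ x y z : ℕ∞, (1 ≤ x ∧ 2 ≤ x + y ∧ 3 ≤ x + y + z) ↔
      ¬ (x = 0 ∨ (x = 1 ∧ y = 0) ∨ (x = 1 ∧ y = 1 ∧ z = 0) ∨ (x = 2 ∧ y = 0 ∧ z = 0)) := by
    intro x y z
    induction x using ENat.recTopCoe with
    | top => simp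
    | coe x =>
    induction y using ENat.recTopCoe with
    | top =>
      norm_cast
      simp
      omega
    | coe y =>
    induction z using ENat.recTopCoe with
    | top =>
      norm_cast
      simp
      omega
    | coe z =>
      norm_cast
      omega
  have hset : {ω | 1 ≤ pointCount (Φ ω) (meanDisc lam a) ∧
      2 ≤ pointCount (Φ ω) (meanDisc lam b) ∧ 3 ≤ pointCount (Φ ω) (meanDisc lam c)} =
      ({ω | X ω = 0} ∪ ({ω | X ω = 1 ∧ Y ω = 0} ∪ ({ω | X ω = 1 ∧ Y ω = 1 ∧ Z ω = 0} ∪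
        {ω | X ω = 2 ∧ Y ω = 0 ∧ Z ω = 0})))ᶜ := by
    ext ω
    have := harith (X ω) (Y ω) (Z ω)
    rw [← hc, ← hb] at this
    exact this
  have p1 : P.real {ω | X ω = 0} = Real.exp (-a) := by
    have := hΦ.count_law _ (measurableSet_meanDisc lam a) (isBounded_meanDisc lam a) 0
    rw [volume_real_meanDisc hlam ha] at this
    simpa using this
  have p2 : P.real {ω | X ω = 1 ∧ Y ω = 0} = a * Real.exp (-b) := by
    simpa using hΦ.real_two_discs hlam ha hab 1 0
  have p3 : P.real {ω | X ω = 1 ∧ Y ω = 1 ∧ Z ω = 0} = a * (b - a) * Real.exp (-c) := by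
    simpa using hΦ.real_three_discs hlam ha hab hbc 1 1 0
  have p4 : P.real {ω | X ω = 2 ∧ Y ω = 0 ∧ Z ω = 0} = a ^ 2 / 2 * Real.exp (-c) := by
    simpa using hΦ.real_three_discs hlam ha hab hbc 2 0 0
  have d1 : Disjoint {ω | X ω = 1 ∧ Y ω = 1 ∧ Z ω = 0} {ω | X ω = 2 ∧ Y ω = 0 ∧ Z ω = 0} :=
    Set.disjoint_left.2 fun ω h h' => by
      have := h.1.symm.trans h'.1
      norm_num at this
  have d2 : Disjoint {ω | X ω = 1 ∧ Y ω = 0} ({ω | X ω = 1 ∧ Y ω = 1 ∧ Z ω = 0} ∪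
      {ω | X ω = 2 ∧ Y ω = 0 ∧ Z ω = 0}) :=
    Set.disjoint_left.2 fun ω h h' => by
      rcases h' with h' | h'
      · have := h.2.symm.trans h'.2.1
        norm_num at this
      · have := h.1.symm.trans h'.1
        norm_num at this
  have d3 : Disjoint {ω | X ω = 0} ({ω | X ω = 1 ∧ Y ω = 0} ∪
      ({ω | X ω = 1 ∧ Y ω = 1 ∧ Z ω = 0} ∪ {ω | X ω = 2 ∧ Y ω = 0 ∧ Z ω = 0})) :=
    Set.disjoint_left.2 fun ω (h : X ω = 0) h' => by
      rcases h' with h' | h' | h'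
      · have := h.symm.trans h'.1
        norm_num at this
      · have := h.symm.trans h'.1
        norm_num at this
      · have := h.symm.trans h'.1
        norm_num at this
  have m3 := (hXYZ 1 1 0).union (hXYZ 2 0 0)
  have m2 := (hXY 1 0).union m3
  rw [hset, probReal_compl_eq_one_sub (hXm.union m2), measureReal_union d3 m2,
    measureReal_union d2 m3, measureReal_union d1 (hXYZ 2 0 0), p1, p2, p3, p4]
  ring

/-- A disc of radius zero has area zero, so its count is Poisson with mean zero. -/
theorem ae_count_origin (hΦ : IsHomogeneousPoissonProcess P Φ lam) [IsProbabilityMeasure P] :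
    ∀ᵐ ω ∂P, pointCount (Φ ω) (Metric.closedBall 0 0) = 0 := by
  have hm : MeasurableSet (Metric.closedBall (0 : Plane) 0) :=
    Metric.isClosed_closedBall.measurableSet
  have h := hΦ.count_law (Metric.closedBall 0 0) hm Metric.isBounded_closedBall 0
  have h0 : volume.real (Metric.closedBall (0 : Plane) 0) = 0 := by
    rw [Measure.real, EuclideanSpace.volume_closedBall_fin_two]; simp
  rw [h0] at h
  have hm' : MeasurableSet {ω | ¬ pointCount (Φ ω) (Metric.closedBall 0 0) = 0} :=
    hΦ.measurableSet_count hm {0}ᶜ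
  rw [ae_iff, ← prob_compl_eq_one_iff hm']
  have h1 : {ω | ¬ pointCount (Φ ω) (Metric.closedBall 0 0) = 0}ᶜ =
    {ω | pointCount (Φ ω) (Metric.closedBall 0 0) = ((0 : ℕ) : ℕ∞)} := by ext ω; simp
  have h2 : P.real {ω | ¬ pointCount (Φ ω) (Metric.closedBall 0 0) = 0}ᶜ = 1 := by
    rw [h1, h]; simp
  rw [Measure.real] at h2
  exact (ENNReal.toReal_eq_one_iff _).1 h2

open Filter Topology in
theorem ae_exists_count_ge (hΦ : IsHomogeneousPoissonProcess P Φ lam) [IsProbabilityMeasure P]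
    (hlam : 0 < lam) :
    ∀ᵐ ω ∂P, ∀ k : ℕ, ∃ n : ℕ, (k : ℕ∞) ≤ pointCount (Φ ω) (Metric.closedBall 0 (n : ℝ)) := by
  rw [ae_all_iff]
  intro k
  rw [ae_iff]
  set B := {ω | ¬ ∃ n : ℕ, (k : ℕ∞) ≤ pointCount (Φ ω) (Metric.closedBall 0 (n : ℝ))}
  have hvol : ∀ n : ℕ, lam * volume.real (Metric.closedBall (0 : Plane) n) =
      lam * π * (n : ℝ) ^ 2 := by
    intro n
    rw [Measure.real, EuclideanSpace.volume_closedBall_fin_two, ENNReal.toReal_mul,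
      ENNReal.toReal_pow, ENNReal.toReal_ofReal n.cast_nonneg, ENNReal.toReal_ofReal pi_pos.le]
    ring
  -- Having fewer than `k` points in every disc implies it for the disc of radius `n`, and that
  -- probability is a polynomial in the mean times a decaying exponential.
  have hle : ∀ n : ℕ, P.real B ≤ ∑ j ∈ Finset.range k,
      (lam * π * (n : ℝ) ^ 2) ^ j / (j.factorial : ℝ) * Real.exp (-(lam * π * (n : ℝ) ^ 2)) := by
    intro n
    have hsub : B ⊆ ⋃ j ∈ Finset.range k,
        {ω | pointCount (Φ ω) (Metric.closedBall 0 (n : ℝ)) = (j : ℕ∞)} := by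
      intro ω hω
      have hlt : pointCount (Φ ω) (Metric.closedBall 0 (n : ℝ)) < k := by
        by_contra h
        exact hω ⟨n, not_lt.1 h⟩
      obtain ⟨j, hj⟩ := ENat.ne_top_iff_exists.1 hlt.ne_top
      rw [← hj] at hlt
      exact mem_iUnion₂.2 ⟨j, Finset.mem_range.2 (by exact_mod_cast hlt), hj.symm⟩
    refine (measureReal_mono hsub (measure_ne_top _ _)).trans ((measureReal_biUnion_finset_le _ _).trans (le_of_eq ?_))
    refine Finset.sum_congr rfl fun j _ => ?_
    rw [hΦ.count_law _ Metric.isClosed_closedBall.measurableSet Metric.isBounded_closedBall, hvol]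
  have hlim : Tendsto (fun n : ℕ => ∑ j ∈ Finset.range k,
      (lam * π * (n : ℝ) ^ 2) ^ j / (j.factorial : ℝ) * Real.exp (-(lam * π * (n : ℝ) ^ 2)))
      atTop (𝓝 0) := by
    have hx : Tendsto (fun n : ℕ => lam * π * (n : ℝ) ^ 2) atTop atTop :=
      ((tendsto_pow_atTop two_ne_zero).comp tendsto_natCast_atTop_atTop).const_mul_atTop
        (mul_pos hlam pi_pos)
    rw [← Finset.sum_const_zero (s := Finset.range k)]
    refine tendsto_finsetSum _ fun j _ => ?_
    have h := ((tendsto_pow_mul_exp_neg_atTop_nhds_zero j).comp hx).div_const (j.factorial : ℝ)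
    rw [zero_div] at h
    refine h.congr fun n => ?_
    simp only [Function.comp_apply]
    ring
  have h0 : P.real B = 0 :=
    le_antisymm (ge_of_tendsto' hlim hle) measureReal_nonneg
  exact (measureReal_eq_zero_iff (measure_ne_top P B)).1 h0

theorem ae_isRegularConfiguration (hΦ : IsHomogeneousPoissonProcess P Φ lam)
    [IsProbabilityMeasure P] (hlam : 0 < lam) : ∀ᵐ ω ∂P, IsRegularConfiguration (Φ ω) := by
  filter_upwards [hΦ.locallyFinite, hΦ.ae_count_origin, hΦ.ae_exists_count_ge hlam]
    with ω h1 h2 h3 using ⟨h1, h3, h2⟩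

end IsHomogeneousPoissonProcess

/-! ### From counts to the law of the rescaled squared distances. -/

/-- The mean number of points of a homogeneous Poisson process in the disc around the origin that
reaches to its `(i + 1)`-th closest point. -/
noncomputable def meanDist (lam : ℝ) (X : Set Plane) (i : ℕ) : ℝ :=
  π * lam * nearestDist X i ^ 2

theorem meanDist_nonneg {lam : ℝ} (hlam : 0 < lam) (X : Set Plane) (i : ℕ) :
    0 ≤ meanDist lam X i := by
  unfold meanDist; positivity

theorem IsRegularConfiguration.meanDist_le_iff {X : Set Plane} (hX : IsRegularConfiguration X)
    {lam : ℝ} (hlam : 0 < lam) (i : ℕ) {t : ℝ} (ht : 0 ≤ t) :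
    meanDist lam X i ≤ t ↔ ((i + 1 : ℕ) : ℕ∞) ≤ pointCount X (meanDisc lam t) := by
  rw [meanDisc, ← hX.nearestDist_le_iff i (Real.sqrt_nonneg _),
    Real.le_sqrt (nearestDist_nonneg X i) (by positivity), meanDist, le_div_iff₀ (by positivity),
    mul_comm]

theorem IsRegularConfiguration.meanDist_mono {X : Set Plane} (hX : IsRegularConfiguration X)
    {lam : ℝ} (hlam : 0 < lam) : Monotone (meanDist lam X) := by
  intro i j hij
  have := hX.nearestDist_mono hij
  have := nearestDist_nonneg X i
  unfold meanDist
  gcongr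

namespace IsHomogeneousPoissonProcess

variable {Ω : Type*} [MeasurableSpace Ω] {P : Measure Ω} {Φ : Ω → Set Plane} {lam : ℝ}

/-- Sublevel sets agree with measurable count events only on regular configurations, hence almost
surely; this gives null measurability, which suffices for a real-valued function. -/
theorem aemeasurable_meanDist (hΦ : IsHomogeneousPoissonProcess P Φ lam) [IsProbabilityMeasure P]
    (hlam : 0 < lam) (i : ℕ) : AEMeasurable (fun ω => meanDist lam (Φ ω) i) P := by
  refine NullMeasurable.aemeasurable ?_
  have h : ∀ t : ℝ, NullMeasurableSet ((fun ω => meanDist lam (Φ ω) i) ⁻¹' Iic t) P := by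
    intro t
    rcases lt_or_ge t 0 with ht | ht
    · have : (fun ω => meanDist lam (Φ ω) i) ⁻¹' Iic t = ∅ :=
        eq_empty_of_forall_notMem fun ω hω =>
          absurd ((meanDist_nonneg hlam (Φ ω) i).trans hω) (not_le.2 ht)
      rw [this]
      exact nullMeasurableSet_empty
    · refine (hΦ.measurableSet_count (measurableSet_meanDisc lam t)
        (Ici ((i + 1 : ℕ) : ℕ∞))).nullMeasurableSet.congr ?_
      filter_upwards [hΦ.ae_isRegularConfiguration hlam] with ω hω
      exact propext (hω.meanDist_le_iff hlam i ht).symm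
  exact measurable_of_Iic (δ := NullMeasurableSpace Ω P) h

/-- Both laws live on ordered nonnegative triples, and on ordered boxes `real_counts_ge` and
`firstThreeLaw_Iic` give the same value. -/
theorem map_meanDist (hΦ : IsHomogeneousPoissonProcess P Φ lam) [IsProbabilityMeasure P]
    (hlam : 0 < lam) :
    P.map (fun ω => (meanDist lam (Φ ω) 0, meanDist lam (Φ ω) 1, meanDist lam (Φ ω) 2)) =
      firstThreeLaw := by
  have hU : AEMeasurable (fun ω =>
      (meanDist lam (Φ ω) 0, meanDist lam (Φ ω) 1, meanDist lam (Φ ω) 2)) P :=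
    (hΦ.aemeasurable_meanDist hlam 0).prodMk
      ((hΦ.aemeasurable_meanDist hlam 1).prodMk (hΦ.aemeasurable_meanDist hlam 2))
  have := Measure.isProbabilityMeasure_map hU
  refine measure_ext_of_ordered_boxes ?_ firstThreeLaw_ordered fun a b c ha hab hbc => ?_
  · have hm : MeasurableSet {q : ℝ × ℝ × ℝ | 0 ≤ q.1 ∧ q.1 ≤ q.2.1 ∧ q.2.1 ≤ q.2.2} :=
      (measurableSet_le measurable_const measurable_fst).inter
        ((measurableSet_le measurable_fst (by fun_prop)).inter
          (measurableSet_le (f := fun q : ℝ × ℝ × ℝ => q.2.1) (g := fun q => q.2.2)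
            (by fun_prop) (by fun_prop)))
    rw [ae_map_iff hU hm]
    filter_upwards [hΦ.ae_isRegularConfiguration hlam] with ω hω
    exact ⟨meanDist_nonneg hlam _ _, hω.meanDist_mono hlam (by norm_num),
      hω.meanDist_mono hlam (by norm_num)⟩
  · rw [firstThreeLaw_Iic ha hab hbc, ← hΦ.real_counts_ge hlam ha hab hbc, ofReal_measureReal,
      Measure.map_apply_of_aemeasurable hU
        (measurableSet_Iic.prod (measurableSet_Iic.prod measurableSet_Iic))]
    refine measure_congr ?_
    filter_upwards [hΦ.ae_isRegularConfiguration hlam] with ω hω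
    refine propext ?_
    have h0 := hω.meanDist_le_iff hlam 0 ha
    have h1 := hω.meanDist_le_iff hlam 1 (ha.trans hab)
    have h2 := hω.meanDist_le_iff hlam 2 ((ha.trans hab).trans hbc)
    exact and_congr h0 (and_congr h1 h2)

end IsHomogeneousPoissonProcess

end

/-! ### The two probabilities. -/

theorem lemma3 {Ω : Type*} [MeasurableSpace Ω] (P : Measure Ω) [IsProbabilityMeasure P]
    (Φ : Ω → Set Plane) (lam : ℝ) (hlam : 0 < lam) (hΦ : IsHomogeneousPoissonProcess P Φ lam)
    (c α Rmin A : ℝ) (hc : 0 < c) (hα : 0 < α) (hRmin : 0 < Rmin) (hA : A = (2 : ℝ) ^ (Rmin / α))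
    (Nstar : Ω → ℕ) (hNstar : ∀ ω, Nstar ω = optimalNumLinks (channelCoeff c α (Φ ω)) Rmin) :
    (NullMeasurableSet {ω | Nstar ω = 1} P ∧ P.real {ω | Nstar ω = 1} = 1 / A ^ 2) ∧
    (NullMeasurableSet {ω | Nstar ω = 2} P ∧
      P.real {ω | Nstar ω = 2} = Real.log (A ^ 2) / A ^ 2) := by
  have hA1 : 1 ≤ A := hA ▸ Real.one_le_rpow one_le_two (by positivity)
  have hA0 : 0 < A := by linarith
  have hB : 1 ≤ A ^ 2 := one_le_pow₀ hA1
  have hU : AEMeasurable (fun ω =>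
      (meanDist lam (Φ ω) 0, meanDist lam (Φ ω) 1, meanDist lam (Φ ω) 2)) P :=
    (hΦ.aemeasurable_meanDist hlam 0).prodMk
      ((hΦ.aemeasurable_meanDist hlam 1).prodMk (hΦ.aemeasurable_meanDist hlam 2))
  set U : Ω → ℝ × ℝ × ℝ := fun ω =>
    (meanDist lam (Φ ω) 0, meanDist lam (Φ ω) 1, meanDist lam (Φ ω) 2)
  set E₁ : Set (ℝ × ℝ × ℝ) := {q | A ^ 2 * q.1 ≤ q.2.1}
  set E₂ : Set (ℝ × ℝ × ℝ) := {q | A ^ 2 * (q.1 * q.2.1) ≤ q.2.2 ^ 2}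
  have hE₁ : MeasurableSet E₁ := measurableSet_mul_fst_le (A ^ 2)
  have hE₂ : MeasurableSet E₂ := measurableSet_mul_mul_le_sq (A ^ 2)
  have n₁ : NullMeasurableSet (U ⁻¹' E₁) P := hU.nullMeasurableSet_preimage hE₁
  have n₂ : NullMeasurableSet (U ⁻¹' E₂) P := hU.nullMeasurableSet_preimage hE₂
  -- Both inequalities are homogeneous in the distances, so after squaring the factor `π * lam`, or
  -- its square, can be inserted on each side.
  have key : ∀ ω, IsRegularConfiguration (Φ ω) →
      (A * nearestDist (Φ ω) 0 ≤ nearestDist (Φ ω) 1 ↔ U ω ∈ E₁) ∧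
      (A * (nearestDist (Φ ω) 0 * nearestDist (Φ ω) 1) ≤ nearestDist (Φ ω) 2 ^ 2 ↔ U ω ∈ E₂) := by
    intro ω hω
    have h0 := hω.nearestDist_pos 0
    have h1 := hω.nearestDist_pos 1
    have h2 := hω.nearestDist_pos 2
    have hpl : 0 < Real.pi * lam := mul_pos Real.pi_pos hlam
    constructor
    · rw [← sq_le_sq₀ (by positivity) h1.le, ← mul_le_mul_iff_of_pos_left hpl]
      simp only [U, E₁, Set.mem_ofPred_eq, meanDist]
      rw [show Real.pi * lam * (A * nearestDist (Φ ω) 0) ^ 2 =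
        A ^ 2 * (Real.pi * lam * nearestDist (Φ ω) 0 ^ 2) by ring]
    · rw [← sq_le_sq₀ (by positivity) (by positivity), ← mul_le_mul_iff_of_pos_left (pow_pos hpl 2)]
      simp only [U, E₂, Set.mem_ofPred_eq, meanDist]
      ring_nf
  have e₁ : {ω | Nstar ω = 1} =ᵐ[P] U ⁻¹' E₁ := by
    filter_upwards [hΦ.ae_isRegularConfiguration hlam] with ω hω
    refine propext ?_
    change Nstar ω = 1 ↔ U ω ∈ E₁
    rw [hNstar, hω.optimalNumLinks_eq_one_iff hc hα hRmin hA, (key ω hω).1]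
  have e₂ : {ω | Nstar ω = 2} =ᵐ[P] (U ⁻¹' E₂ \ U ⁻¹' E₁ : Set Ω) := by
    filter_upwards [hΦ.ae_isRegularConfiguration hlam] with ω hω
    refine propext ?_
    change Nstar ω = 2 ↔ U ω ∈ E₂ ∧ ¬ U ω ∈ E₁
    rw [hNstar, hω.optimalNumLinks_eq_two_iff hc hα hRmin hA, (key ω hω).1, (key ω hω).2]
  have p₁ : P.real (U ⁻¹' E₁) = 1 / A ^ 2 := by
    rw [Measure.real, ← Measure.map_apply_of_aemeasurable hU hE₁, hΦ.map_meanDist hlam,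
      firstThreeLaw_mul_fst_le hB, ENNReal.toReal_ofReal (by positivity)]
  have p₂ : P.real (U ⁻¹' E₂) = 1 / A ^ 2 + Real.log (A ^ 2) / A ^ 2 := by
    have := Real.log_nonneg hB
    rw [Measure.real, ← Measure.map_apply_of_aemeasurable hU hE₂, hΦ.map_meanDist hlam,
      firstThreeLaw_mul_mul_le_sq hB, ENNReal.toReal_ofReal (by positivity)]
  -- If one link suffices then so do two: `A ^ 2 * u₀ ≤ u₁ ≤ u₂` gives `A ^ 2 * u₀ * u₁ ≤ u₁ ^ 2 ≤
  -- u₂ ^ 2`. The probability of the difference is therefore the difference of the probabilities.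
  have hsub : (U ⁻¹' E₂ ∩ U ⁻¹' E₁ : Set Ω) =ᵐ[P] U ⁻¹' E₁ := by
    filter_upwards [hΦ.ae_isRegularConfiguration hlam] with ω hω
    refine propext (and_iff_right_of_imp fun h => ?_)
    have h' : A ^ 2 * (U ω).1 ≤ (U ω).2.1 := h
    have hm : (U ω).2.1 ≤ (U ω).2.2 := hω.meanDist_mono hlam (by norm_num)
    have h0 : 0 ≤ (U ω).2.1 := meanDist_nonneg hlam _ _
    change A ^ 2 * ((U ω).1 * (U ω).2.1) ≤ (U ω).2.2 ^ 2
    nlinarith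
  refine ⟨⟨n₁.congr e₁.symm, ?_⟩, (n₂.diff n₁).congr e₂.symm, ?_⟩
  · rw [measureReal_congr e₁, p₁]
  · have h := measureReal_inter_add_sdiff₀ (μ := P) (s := U ⁻¹' E₂) n₁
    rw [measureReal_congr hsub, p₁, p₂] at h
    rw [measureReal_congr e₂]
    linarith
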